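/- Let $A$ be a finite alphabet. A ranker is a nonempty word $r$ over $\{X_a,Y_a : a\in A\}$, executed on words $u=a_1\cdots a_k\in A^*$ from left to right: from a position $x\in\{0,\dots,k+1\}$, $X_a$ moves to the smallest $y>x$ with $a_y=a$ and $Y_a$ moves to the largest $y<x$ with $a_y=a$ (undefined if there is no such $y$). If $r$ begins with an $X$-letter it starts at $0$, if it begins with a $Y$-letter it starts at $k+1$; $r(u)$ denotes the position reached, if it is defined. The depth of $r$ is its length, and its blocks are its maximal factors consisting only of $X$-letters or only of $Y$-letters. Let $R_{m,n}$ be the set of rankers of depth at most $n$ with at most $m$ blocks, and let $R^X_{m,n}$, $R^Y_{m,n}$ be the sets of those that begin with an $X$-letter, respectively a $Y$-letter. Write $\mathrm{ord}(i,j)\in\{<,=,>\}$ for the order type of two positions. Let $u\equiv_{m,n}v$ if the same rankers in $R_{m,n}$ are defined on $u$ and $v$, and $\mathrm{ord}(r(u),s(u))=\mathrm{ord}(r(v),s(v))$ for all pairs $(r,s)$ of rankers defined on both $u$ and $v$ that lie in $R^X_{m,n}\times R^Y_{m,n-1}$, in $R^Y_{m,n}\times R^X_{m,n-1}$, in $R^X_{m,n}\times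 R^X_{m-1,n-1}$ or in $R^Y_{m,n}\times R^Y_{m-1,n-1}$. For a finite monoid $M$ and $x,y\in M$, let $x\le_J y$ if $x\in MyM$, and $x<_J y$ if moreover $y\not\le_J x$; $M$ is $J$-trivial if $x\le_J y\le_J x$ implies $x=y$. Let $x\sim_K y$ if for every idempotent $e\in M$ either $ex,ey<_J e$ or $ex=ey$; let $x\sim_D y$ if for every idempotent $f\in M$ either $xf,yf<_J f$ or $xf=yf$. These are congruences on $M$. Define classes of finite monoids by letting $\mathbf R_1=\mathbf L_1$ be the class of finite $J$-trivial monoids and, for $m\ge1$, $M\in\mathbf R_{m+1}$ iff $M/{\sim_K}\in\mathbf L_m$, and $M\in\mathbf L_{m+1}$ iff $M/{\sim_D}\in\mathbf R_m$. **Proposition.** For every $m\ge1$, every finite monoid $M\in\mathbf R_{m+1}\cap\mathbf L_{m+1}$ and every monoid morphism $\varphi:A^*\to M$, there exists an integer $n\ge 0$ such that $u\equiv_{m,n}v$ implies $\varphi(u)=\varphi(v)$ for all $u,v\in A^*$. -/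

import Mathlib

namespace RankerHierarchy

universe u v

/-! ### Rankers -/

/-- The modalities `X a` ("next `a`") and `Y a` ("previous `a`"). -/
inductive Modality (A : Type u) : Type u
  | X (a : A) : Modality A
  | Y (a : A) : Modality A

/-- Whether the modality is of the form `X a`. -/
def Modality.isX {A : Type u} : Modality A → Bool
  | .X _ => true
  | .Y _ => false

/-- The set of `a`-positions of a word `w`; positions are numbered `1, …, |w|`. -/
def positions {A : Type u} [DecidableEq A] (w : List A) (a : A) : Finset ℕ :=
  (Finset.Icc 1 w.length).filter (fun y => w[y - 1]? = some a)

/-- Minimum of a finite set of positions; undefined (`none`) on the empty set. -/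
def minPos (S : Finset ℕ) : Option ℕ :=
  if h : S.Nonempty then some (S.min' h) else none

/-- Maximum of a finite set of positions; undefined (`none`) on the empty set. -/
def maxPos (S : Finset ℕ) : Option ℕ :=
  if h : S.Nonempty then some (S.max' h) else none

/-- `Z(w, x)`: the first `a`-position to the right of `x` if `Z = X a`, and the last `a`-position
to the left of `x` if `Z = Y a`. -/
def Modality.step {A : Type u} [DecidableEq A] (w : List A) (x : ℕ) : Modality A → Option ℕ
  | .X a => minPos ((positions w a).filter (fun y => x < y))
  | .Y a => maxPos ((positions w a).filter (fun y => y < x))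

/-- The position from which an initial modality is executed: `0` for `X a`, `|w| + 1` for `Y a`. -/
def Modality.start {A : Type u} (w : List A) : Modality A → ℕ
  | .X _ => 0
  | .Y _ => w.length + 1

/-- `r(w, x)`: execution of the word of modalities `r`, from left to right, from position `x`. -/
def evalFrom {A : Type u} [DecidableEq A] (w : List A) : List (Modality A) → ℕ → Option ℕ
  | [], x => some x
  | Z :: s, x => (Z.step w x).bind (evalFrom w s)

/-- `r(w)`: the position defined by the ranker `r` on `w`, or `none` if `r` is undefined on `w`.
The empty word is not a ranker; its value is irrelevant. -/
def eval {A : Type u} [DecidableEq A] (w : List A) : List (Modality A) → Option ℕ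
  | [] => none
  | Z :: s => evalFrom w (Z :: s) (Z.start w)

/-- The number of blocks, i.e. of maximal factors consisting only of `X`-modalities or only of
`Y`-modalities. -/
def blocks {A : Type u} : List (Modality A) → ℕ
  | [] => 0
  | [_] => 1
  | Z :: Z' :: s => blocks (Z' :: s) + (if Z.isX = Z'.isX then 0 else 1)

/-- `R_{m,n}`: the rankers (nonempty words of modalities) of depth at most `n` with at most `m`
blocks. -/
def Rankers (A : Type u) (m n : ℕ) : Set (List (Modality A)) :=
  {r | r ≠ [] ∧ r.length ≤ n ∧ blocks r ≤ m}

/-- The rankers of `R_{m,n}` that start with an `X`-modality. -/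
def RankersX (A : Type u) (m n : ℕ) : Set (List (Modality A)) :=
  {r | r ∈ Rankers A m n ∧ ∃ a s, r = Modality.X a :: s}

/-- The rankers of `R_{m,n}` that start with a `Y`-modality. -/
def RankersY (A : Type u) (m n : ℕ) : Set (List (Modality A)) :=
  {r | r ∈ Rankers A m n ∧ ∃ a s, r = Modality.Y a :: s}

/-- Order type of two possibly undefined positions; undefined if one of them is. -/
def ord : Option ℕ → Option ℕ → Option Ordering
  | some i, some j => some (compare i j)
  | _, _ => none

/-- The relation `≡_{m,n}` on words. Since all rankers have positive depth, `R_{m,0}` is empty, so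
truncated subtraction is harmless in `n - 1`; likewise `R_{0,n}` is empty. -/
structure RankerEquiv {A : Type u} [DecidableEq A] (m n : ℕ) (w w' : List A) : Prop where
  defined : ∀ r ∈ Rankers A m n, (eval w r).isSome ↔ (eval w' r).isSome
  ord_XY : ∀ r ∈ RankersX A m n, ∀ s ∈ RankersY A m (n - 1),
    ord (eval w r) (eval w s) = ord (eval w' r) (eval w' s)
  ord_YX : ∀ r ∈ RankersY A m n, ∀ s ∈ RankersX A m (n - 1),
    ord (eval w r) (eval w s) = ord (eval w' r) (eval w' s)
  ord_XX : ∀ r ∈ RankersX A m n, ∀ s ∈ RankersX A (m - 1) (n - 1),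
    ord (eval w r) (eval w s) = ord (eval w' r) (eval w' s)
  ord_YY : ∀ r ∈ RankersY A m n, ∀ s ∈ RankersY A (m - 1) (n - 1),
    ord (eval w r) (eval w s) = ord (eval w' r) (eval w' s)

/-! ### Finite monoids -/

/-- `x ≤_J y`: `x = p y q` for some `p, q`. -/
def JLe {M : Type v} [Monoid M] (x y : M) : Prop := ∃ p q : M, x = p * y * q

/-- `x <_J y`. -/
def JLt {M : Type v} [Monoid M] (x y : M) : Prop := JLe x y ∧ ¬ JLe y x

/-- `J`-trivial monoids: Green's relation `J` is the identity. -/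
def JTrivial (M : Type v) [Monoid M] : Prop := ∀ x y : M, JLe x y → JLe y x → x = y

/-- `x ∼_K y`: for every idempotent `e`, either `e x, e y <_J e`, or `e x = e y`. -/
def KRel {M : Type v} [Monoid M] (x y : M) : Prop :=
  ∀ e : M, IsIdempotentElem e → (JLt (e * x) e ∧ JLt (e * y) e) ∨ e * x = e * y

/-- `x ∼_D y`: for every idempotent `f`, either `x f, y f <_J f`, or `x f = y f`. -/
def DRel {M : Type v} [Monoid M] (x y : M) : Prop :=
  ∀ f : M, IsIdempotentElem f → (JLt (x * f) f ∧ JLt (y * f) f) ∨ x * f = y * f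

theorem exists_idem_pow {M : Type v} [Monoid M] [Finite M] (x : M) :
    ∃ k : ℕ, 0 < k ∧ IsIdempotentElem (x ^ k) := by
  obtain ⟨i, j, hij, h⟩ := Finite.exists_ne_map_eq_of_infinite (fun n : ℕ => x ^ n)
  have key : ∀ i d : ℕ, 0 < d → x ^ i = x ^ (i + d) →
      ∃ k : ℕ, 0 < k ∧ IsIdempotentElem (x ^ k) := by
    intro i d hd h
    have h1 : ∀ t a : ℕ, x ^ (i + a) = x ^ (i + a + t * d) := by
      intro t
      induction t with
      | zero => intro a; simp
      | succ t ih =>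
        intro a
        rw [ih a, show i + a + (t + 1) * d = (i + d) + (a + t * d) by ring, pow_add x (i + d),
          ← h, ← pow_add, add_assoc]
    refine ⟨(i + 1) * d, by positivity, ?_⟩
    have hle : i ≤ (i + 1) * d := by nlinarith
    obtain ⟨a, ha⟩ := Nat.exists_eq_add_of_le hle
    have := h1 (i + 1) a
    rw [← ha, pow_add] at this
    exact this.symm
  rcases lt_or_gt_of_ne hij with hlt | hlt
  · exact key i (j - i) (by omega) (by simpa [Nat.add_sub_cancel' hlt.le] using h)
  · exact key j (i - j) (by omega) (by simpa [Nat.add_sub_cancel' hlt.le] using h.symm)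

theorem right_inv_of_JLe {M : Type v} [Monoid M] [Finite M] {e w : M}
    (h : JLe e (e * w)) : ∃ z, e = e * w * z := by
  obtain ⟨p, q, h⟩ := h
  obtain ⟨k, hk, hi⟩ := exists_idem_pow p
  have h1 : ∀ n : ℕ, e = p ^ n * e * (w * q) ^ n := by
    intro n
    induction n with
    | zero => simp
    | succ n ih =>
      calc e = p ^ n * e * (w * q) ^ n := ih
        _ = p ^ n * (p * (e * w) * q) * (w * q) ^ n := by rw [← h]
        _ = _ := by rw [pow_succ, pow_succ' (w * q)]; simp only [mul_assoc]
  have h2 : p ^ k * e = e := by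
    conv_lhs => rw [h1 k]
    rw [← mul_assoc, ← mul_assoc, hi.eq, ← h1 k]
  obtain ⟨j, rfl⟩ : ∃ j, k = j + 1 := ⟨k - 1, by omega⟩
  refine ⟨q * (w * q) ^ j, ?_⟩
  have h3 := h1 (j + 1)
  rw [h2, pow_succ'] at h3
  simpa only [mul_assoc] using h3

theorem left_inv_of_JLe {M : Type v} [Monoid M] [Finite M] {e w : M}
    (h : JLe e (w * e)) : ∃ z, e = z * (w * e) := by
  obtain ⟨p, q, h⟩ := h
  obtain ⟨k, hk, hi⟩ := exists_idem_pow q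
  have h1 : ∀ n : ℕ, e = (p * w) ^ n * e * q ^ n := by
    intro n
    induction n with
    | zero => simp
    | succ n ih =>
      calc e = (p * w) ^ n * e * q ^ n := ih
        _ = (p * w) ^ n * (p * (w * e) * q) * q ^ n := by rw [← h]
        _ = _ := by rw [pow_succ (p * w), pow_succ' q]; simp only [mul_assoc]
  have h2 : e * q ^ k = e := by
    conv_lhs => rw [h1 k]
    rw [mul_assoc, hi.eq, ← h1 k]
  obtain ⟨j, rfl⟩ : ∃ j, k = j + 1 := ⟨k - 1, by omega⟩
  refine ⟨(p * w) ^ j * p, ?_⟩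
  have h3 := h1 (j + 1)
  rw [mul_assoc, h2, pow_succ] at h3
  simpa only [mul_assoc] using h3

theorem JLe.trans {M : Type v} [Monoid M] {x y z : M} (h : JLe x y) (h' : JLe y z) : JLe x z := by
  obtain ⟨p, q, rfl⟩ := h
  obtain ⟨p', q', rfl⟩ := h'
  exact ⟨p * p', q' * q, by simp only [mul_assoc]⟩

theorem JLe.mul_left {M : Type v} [Monoid M] (w x : M) : JLe (w * x) x := ⟨w, 1, by simp⟩

theorem JLe.mul_right {M : Type v} [Monoid M] (x w : M) : JLe (x * w) x := ⟨1, w, by simp⟩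

theorem JLt.of_le {M : Type v} [Monoid M] {x y z : M} (h : JLe x y) (h' : JLt y z) : JLt x z :=
  ⟨h.trans h'.1, fun h'' => h'.2 (h''.trans h)⟩

theorem KRel.equivalence (M : Type v) [Monoid M] : Equivalence (KRel (M := M)) where
  refl x e _ := Or.inr rfl
  symm h e he := (h e he).imp And.symm Eq.symm
  trans h h' e he := by
    rcases h e he with h1 | h1 <;> rcases h' e he with h2 | h2
    · exact Or.inl ⟨h1.1, h2.2⟩
    · exact Or.inl ⟨h1.1, h2 ▸ h1.2⟩
    · exact Or.inl ⟨h1 ▸ h2.1, h2.2⟩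
    · exact Or.inr (h1.trans h2)

theorem DRel.equivalence (M : Type v) [Monoid M] : Equivalence (DRel (M := M)) where
  refl x e _ := Or.inr rfl
  symm h e he := (h e he).imp And.symm Eq.symm
  trans h h' e he := by
    rcases h e he with h1 | h1 <;> rcases h' e he with h2 | h2
    · exact Or.inl ⟨h1.1, h2.2⟩
    · exact Or.inl ⟨h1.1, h2 ▸ h1.2⟩
    · exact Or.inl ⟨h1 ▸ h2.1, h2.2⟩
    · exact Or.inr (h1.trans h2)

theorem KRel.mul_right {M : Type v} [Monoid M] {x y : M} (h : KRel x y) (w : M) :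
    KRel (x * w) (y * w) := by
  intro e he
  rw [← mul_assoc, ← mul_assoc]
  rcases h e he with h1 | h1
  · exact Or.inl ⟨.of_le (.mul_right _ _) h1.1, .of_le (.mul_right _ _) h1.2⟩
  · exact Or.inr (by rw [h1])

theorem DRel.mul_left {M : Type v} [Monoid M] {x y : M} (h : DRel x y) (w : M) :
    DRel (w * x) (w * y) := by
  intro e he
  rw [mul_assoc, mul_assoc]
  rcases h e he with h1 | h1
  · exact Or.inl ⟨.of_le (.mul_left _ _) h1.1, .of_le (.mul_left _ _) h1.2⟩
  · exact Or.inr (by rw [h1])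

theorem KRel.mul_left {M : Type v} [Monoid M] [Finite M] {x y : M} (h : KRel x y) (w : M) :
    KRel (w * x) (w * y) := by
  intro e he
  rw [← mul_assoc, ← mul_assoc]
  by_cases hw : JLe e (e * w)
  · obtain ⟨z, hz⟩ := right_inv_of_JLe hw
    have hee : e * e = e := he
    -- the idempotent `z e w` is `J`-equivalent to `e`
    have hf : IsIdempotentElem (z * (e * w)) := by
      change z * (e * w) * (z * (e * w)) = _
      calc z * (e * w) * (z * (e * w)) = z * ((e * w * z) * (e * w)) := by simp only [mul_assoc]
        _ = z * (e * w) := by rw [← hz, ← mul_assoc e, hee]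
    have hb : ∀ t : M, e * w * t = e * w * (z * (e * w) * t) := by
      intro t
      calc e * w * t = e * e * w * t := by rw [hee]
        _ = (e * w * z) * e * w * t := by rw [← hz]
        _ = _ := by simp only [mul_assoc]
    have hfe : JLe (z * (e * w)) e := ⟨z, w, by simp only [mul_assoc]⟩
    have hef : JLe e (z * (e * w)) := ⟨e * w, z, by
      have := hb z
      rw [← hz] at this
      simpa only [mul_assoc] using this⟩
    rcases h _ hf with h1 | h1
    · have hlt : ∀ t : M, JLt (z * (e * w) * t) (z * (e * w)) → JLt (e * w * t) e := by
        intro t ht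
        refine ⟨⟨1, w * t, by simp only [mul_assoc, one_mul]⟩, fun hc => ht.2 ?_⟩
        refine hfe.trans (hc.trans ?_)
        rw [hb t]
        exact .mul_left _ _
      exact Or.inl ⟨hlt x h1.1, hlt y h1.2⟩
    · exact Or.inr (by rw [hb x, hb y, h1])
  · have hlt : JLt (e * w) e := ⟨.mul_right _ _, hw⟩
    exact Or.inl ⟨.of_le (.mul_right _ _) hlt, .of_le (.mul_right _ _) hlt⟩

theorem DRel.mul_right {M : Type v} [Monoid M] [Finite M] {x y : M} (h : DRel x y) (w : M) :
    DRel (x * w) (y * w) := by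
  intro e he
  rw [mul_assoc, mul_assoc]
  by_cases hw : JLe e (w * e)
  · obtain ⟨z, hz⟩ := left_inv_of_JLe hw
    have hee : e * e = e := he
    -- the idempotent `w e z` is `J`-equivalent to `e`
    have hf : IsIdempotentElem (w * e * z) := by
      change w * e * z * (w * e * z) = _
      calc w * e * z * (w * e * z) = w * e * (z * (w * e)) * z := by simp only [mul_assoc]
        _ = w * e * z := by rw [← hz, mul_assoc w, hee]
    have hb : ∀ t : M, t * (w * e) = t * (w * e * z) * (w * e) := by
      intro t
      calc t * (w * e) = t * (w * (e * e)) := by rw [hee]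
        _ = t * (w * (e * (z * (w * e)))) := by rw [← hz]
        _ = _ := by simp only [mul_assoc]
    have hfe : JLe (w * e * z) e := ⟨w, z, rfl⟩
    have hef : JLe e (w * e * z) := ⟨z, w * e, by
      have := hb z
      rwa [← hz] at this⟩
    rcases h _ hf with h1 | h1
    · have hlt : ∀ t : M, JLt (t * (w * e * z)) (w * e * z) → JLt (t * (w * e)) e := by
        intro t ht
        refine ⟨⟨t * w, 1, by simp only [mul_assoc, mul_one]⟩, fun hc => ht.2 ?_⟩
        refine hfe.trans (hc.trans ?_)
        rw [hb t]
        exact .mul_right _ _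
      exact Or.inl ⟨hlt x h1.1, hlt y h1.2⟩
    · exact Or.inr (by rw [hb x, hb y, h1])
  · have hlt : JLt (w * e) e := ⟨.mul_left _ _, hw⟩
    exact Or.inl ⟨.of_le (.mul_left _ _) hlt, .of_le (.mul_left _ _) hlt⟩

/-- The congruence `∼_K` of a finite monoid. -/
def KCon (M : Type v) [Monoid M] [Finite M] : Con M where
  r := KRel
  iseqv := KRel.equivalence M
  mul' {_ x y _} h h' :=
    (KRel.equivalence M).trans (h.mul_right y) (h'.mul_left x)

/-- The congruence `∼_D` of a finite monoid. -/
def DCon (M : Type v) [Monoid M] [Finite M] : Con M where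
  r := DRel
  iseqv := DRel.equivalence M
  mul' {_ x y _} h h' :=
    (DRel.equivalence M).trans (h.mul_right y) (h'.mul_left x)

instance conQuotientFinite {M : Type v} [Monoid M] [Finite M] (c : Con M) : Finite c.Quotient :=
  Quotient.finite c.toSetoid

/-- A class of finite monoids. -/
abbrev MonoidClass : Type (v + 1) := ∀ (N : Type v) [Monoid N] [Finite N], Prop

/-- The Mal'cev product of `K` with the class `V`: the finite monoids `M` with `M / ∼_K` in `V`. -/
def MalcevK (V : MonoidClass.{v}) : MonoidClass.{v} :=
  fun M _ _ => V (KCon M).Quotient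

/-- The Mal'cev product of `D` with the class `V`: the finite monoids `M` with `M / ∼_D` in `V`. -/
def MalcevD (V : MonoidClass.{v}) : MonoidClass.{v} :=
  fun M _ _ => V (DCon M).Quotient

mutual

/-- The classes `R_m`, `m ≥ 1`: `R_1 = J` and `R_{m+1}` is the Mal'cev product of `K` with `L_m`.
The index `0` is not used. -/
def ClassR : ℕ → MonoidClass.{v}
  | 0 => fun _ _ _ => False
  | 1 => fun M _ _ => JTrivial M
  | m + 2 => MalcevK (ClassL (m + 1))

/-- The classes `L_m`, `m ≥ 1`: `L_1 = J` and `L_{m+1}` is the Mal'cev product of `D` with `R_m`.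
The index `0` is not used. -/
def ClassL : ℕ → MonoidClass.{v}
  | 0 => fun _ _ _ => False
  | 1 => fun M _ _ => JTrivial M
  | m + 2 => MalcevD (ClassR (m + 1))

end

end RankerHierarchy

namespace RankerHierarchy

universe u v

set_option linter.unusedSectionVars false

/-! ### Closure properties of the classes -/

section Algebra

variable {M N : Type v} [Monoid M] [Monoid N]

-- All the classes lie in the variety DA (`isDA_of_class`). Call a position of a word an R-descent
-- if reading its letter leaves the R-class of the prefix value. In DA the letter of an R-descent
-- cannot occur strictly between the preceding descent and this one, since an idempotent stabilising
-- the prefix would absorb it (`IsDA.notMem_factor_of_rDescent`). So all R-descents are visited by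
-- one block of at most `|M|` `X`-modalities, and dually all L-descents by one block of
-- `Y`-modalities.
--
-- For equivalent `w`, `w'`, mark the R-descents of `w` and the L-descents of `w'`. Rankers
-- transport each mark to the other word, preserving order and letters. Replace `w'` by `w` factor
-- by factor, from left to right, between consecutive marks. At each exchange the left context is
-- R-stable under the factor of `w` and the right context is L-stable under the factor of `w'`
-- (`IsDA.wordVal_eq_of_exchange`).
--
-- For `m = 1` the monoid is R-trivial and L-trivial, so both factors are absorbed by their
-- contexts. For larger `m` the two factors have the same letters, and DA extends stability to the
-- submonoid `S` these letters generate. Between stable contexts, `∼_K` and `∼_D` both imply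
-- equality, hence so does their join on `S` (`sup_le_contextCon`). The quotient of `S` by the join
-- divides both `M/∼_K` and `M/∼_D`, so it lies one level lower in both hierarchies
-- (`class_sup_quotient`). The factors are themselves equivalent one level lower, because a ranker
-- on a factor is simulated on the whole word by prefixing a mark, at the cost of one block
-- (`IsMarkPair.factor_equiv`). Induction on `m` concludes.

theorem JLe.map (f : M →* N) {x y : M} (h : JLe x y) : JLe (f x) (f y) := by
  obtain ⟨p, q, rfl⟩ := h
  exact ⟨f p, f q, by simp⟩

theorem JTrivial.of_injective {f : N →* M} (hf : Function.Injective f) (h : JTrivial M) :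
    JTrivial N :=
  fun _ _ h1 h2 => hf (h _ _ (h1.map f) (h2.map f))

theorem JLe.pow_le (x : M) {k : ℕ} (hk : 0 < k) : JLe (x ^ k) x := by
  obtain ⟨j, rfl⟩ : ∃ j, k = j + 1 := ⟨k - 1, by omega⟩
  exact ⟨x ^ j, 1, by rw [pow_succ, mul_one]⟩

theorem JLe.refl (x : M) : JLe x x := ⟨1, 1, by simp⟩

/-- An idempotent of the image lifts to a `J`-minimal idempotent. -/
theorem exists_minimal_idem_lift [Finite M] {f : M →* N} (hf : Function.Surjective f) {e : N}
    (he : IsIdempotentElem e) :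
    ∃ e' : M, IsIdempotentElem e' ∧ f e' = e ∧ ∀ y : M, JLe y e' → f y = e → JLe e' y := by
  obtain ⟨x, hx⟩ := hf e
  have key : ∀ (n : ℕ) (x : M), f x = e → {y : M | JLe y x}.ncard ≤ n →
      ∃ e' : M, IsIdempotentElem e' ∧ f e' = e ∧ ∀ y : M, JLe y e' → f y = e → JLe e' y := by
    intro n
    induction n with
    | zero =>
      intro x _ hn
      have : {y : M | JLe y x} = ∅ := by
        rwa [Nat.le_zero, Set.ncard_eq_zero (Set.toFinite _)] at hn
      exact absurd (show x ∈ {y : M | JLe y x} from .refl x) (this ▸ Set.notMem_empty x)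
    | succ n ih =>
      intro x hx hn
      by_cases hmin : ∀ y : M, JLe y x → f y = e → JLe x y
      -- The idempotent power of a `J`-minimal preimage stays in the fibre because `e` is
      -- idempotent, and it inherits minimality.
      · obtain ⟨k, hk, hi⟩ := exists_idem_pow x
        have hfk : f (x ^ k) = e := by rw [map_pow, hx, he.pow_eq hk.ne']
        refine ⟨x ^ k, hi, hfk, fun y hy hfy => (JLe.pow_le x hk).trans ?_⟩
        exact hmin y (hy.trans (JLe.pow_le x hk)) hfy
      · push Not at hmin
        obtain ⟨y, hyx, hy, hxy⟩ := hmin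
        refine ih y hy (Nat.lt_succ_iff.1 (lt_of_lt_of_le (Set.ncard_lt_ncard ?_) hn))
        exact ⟨fun z hz => hz.trans hyx, fun hc => hxy (hc (JLe.refl x))⟩
  exact key _ x hx le_rfl

/-- If `x = x z y`, then `x = x (z y)^k` for all `k`; lifted to the `J`-trivial monoid `M`, an
idempotent power of `z y` absorbs `z`. Hence `N` is R-trivial, dually L-trivial, and by finiteness
`J`-trivial. -/
theorem JTrivial.of_surjective [Finite M] {f : M →* N} (hf : Function.Surjective f)
    (h : JTrivial M) : JTrivial N := by
  have hR : ∀ x z : N, ∀ y, x = x * z * y → x * z = x := by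
    intro x z y hx
    obtain ⟨x', rfl⟩ := hf x
    obtain ⟨z', rfl⟩ := hf z
    obtain ⟨y', rfl⟩ := hf y
    obtain ⟨k, hk, hi⟩ := exists_idem_pow (z' * y')
    have h1 : ∀ n : ℕ, f x' = f (x' * (z' * y') ^ n) := by
      intro n
      induction n with
      | zero => simp
      | succ n ih =>
        rw [pow_succ, ← mul_assoc, map_mul, ← ih, map_mul, ← mul_assoc, ← hx]
    have h2 : (z' * y') ^ k * z' = (z' * y') ^ k := by
      refine h _ _ (.mul_right _ _) ?_
      obtain ⟨j, rfl⟩ : ∃ j, k = j + 1 := ⟨k - 1, by omega⟩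
      refine ⟨1, y' * (z' * y') ^ j, ?_⟩
      conv_lhs => rw [← hi.eq]
      rw [pow_succ' _ j]
      simp only [mul_assoc, one_mul]
    rw [h1 k, ← map_mul, mul_assoc, h2]
  have hL : ∀ x z : N, ∀ y, x = y * (z * x) → z * x = x := by
    intro x z y hx
    obtain ⟨x', rfl⟩ := hf x
    obtain ⟨z', rfl⟩ := hf z
    obtain ⟨y', rfl⟩ := hf y
    obtain ⟨k, hk, hi⟩ := exists_idem_pow (y' * z')
    have h1 : ∀ n : ℕ, f x' = f ((y' * z') ^ n * x') := by
      intro n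
      induction n with
      | zero => simp
      | succ n ih =>
        rw [pow_succ', mul_assoc, map_mul, ← ih, map_mul, mul_assoc, ← hx]
    have h2 : z' * (y' * z') ^ k = (y' * z') ^ k := by
      refine h _ _ (.mul_left _ _) ?_
      obtain ⟨j, rfl⟩ : ∃ j, k = j + 1 := ⟨k - 1, by omega⟩
      refine ⟨(y' * z') ^ j * y', 1, ?_⟩
      conv_lhs => rw [← hi.eq]
      rw [pow_succ _ j]
      simp only [mul_assoc, mul_one]
    rw [h1 k, ← map_mul, ← mul_assoc, h2]
  have : Finite N := Finite.of_surjective f hf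
  rintro x y ⟨p, q, hx⟩ ⟨p', q', hy⟩
  obtain ⟨z, hz⟩ := left_inv_of_JLe (e := y) (w := p)
    ⟨p', q * q', by rw [hx] at hy; simpa only [mul_assoc] using hy⟩
  have h1 : p * y = y := hL y p z hz
  rw [h1] at hx
  obtain ⟨z, hz⟩ := right_inv_of_JLe (e := y) (w := q) ⟨p', q', by rw [← hx, ← hy]⟩
  rw [hx, hR y q z hz]

theorem KRel.of_injective {f : N →* M} (hf : Function.Injective f) {x y : N}
    (h : KRel (f x) (f y)) : KRel x y := by
  intro e he
  rcases h (f e) (he.map f) with h1 | h1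
  · rw [← map_mul, ← map_mul] at h1
    exact Or.inl ⟨⟨.mul_right _ _, fun hc => h1.1.2 (hc.map f)⟩,
      ⟨.mul_right _ _, fun hc => h1.2.2 (hc.map f)⟩⟩
  · exact Or.inr (hf (by simpa using h1))

theorem DRel.of_injective {f : N →* M} (hf : Function.Injective f) {x y : N}
    (h : DRel (f x) (f y)) : DRel x y := by
  intro e he
  rcases h (f e) (he.map f) with h1 | h1
  · rw [← map_mul, ← map_mul] at h1
    exact Or.inl ⟨⟨.mul_left _ _, fun hc => h1.1.2 (hc.map f)⟩,
      ⟨.mul_left _ _, fun hc => h1.2.2 (hc.map f)⟩⟩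
  · exact Or.inr (hf (by simpa using h1))

/-- Testing at a `J`-minimal idempotent lift `e'` ensures that a strict drop below `e'` remains
strict in the image: returning to `e` would give an element of the fibre below `e' z`, hence above
`e'`. -/
theorem KRel.map [Finite M] {f : M →* N} (hf : Function.Surjective f) {x y : M} (h : KRel x y) :
    KRel (f x) (f y) := by
  have : Finite N := Finite.of_surjective f hf
  intro e he
  obtain ⟨e', he', rfl, hmin⟩ := exists_minimal_idem_lift hf he
  have key : ∀ z : M, JLt (e' * z) e' → JLt (f e' * f z) (f e') := by
    refine fun z hz => ⟨.mul_right _ _, fun hc => hz.2 ?_⟩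
    obtain ⟨w, hw⟩ := right_inv_of_JLe hc
    obtain ⟨w', rfl⟩ := hf w
    exact (hmin (e' * z * w') ⟨1, z * w', by simp only [one_mul, mul_assoc]⟩
      (by simpa using hw.symm)).trans (.mul_right _ _)
  rcases h e' he' with h1 | h1
  · exact Or.inl ⟨key x h1.1, key y h1.2⟩
  · exact Or.inr (by rw [← map_mul, h1, map_mul])

theorem DRel.map [Finite M] {f : M →* N} (hf : Function.Surjective f) {x y : M} (h : DRel x y) :
    DRel (f x) (f y) := by
  have : Finite N := Finite.of_surjective f hf
  intro e he
  obtain ⟨e', he', rfl, hmin⟩ := exists_minimal_idem_lift hf he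
  have key : ∀ z : M, JLt (z * e') e' → JLt (f z * f e') (f e') := by
    refine fun z hz => ⟨.mul_left _ _, fun hc => hz.2 ?_⟩
    obtain ⟨w, hw⟩ := left_inv_of_JLe hc
    obtain ⟨w', rfl⟩ := hf w
    exact (hmin (w' * (z * e')) ⟨w' * z, 1, by simp only [mul_one, mul_assoc]⟩
      (by simpa using hw.symm)).trans (.mul_left _ _)
  rcases h e' he' with h1 | h1
  · exact Or.inl ⟨key x h1.1, key y h1.2⟩
  · exact Or.inr (by rw [← map_mul, h1, map_mul])

/-- Closure of a class of finite monoids under submonoids and homomorphic images. -/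
structure DivisorClosed (V : MonoidClass.{v}) : Prop where
  of_injective : ∀ (M N : Type v) [Monoid M] [Finite M] [Monoid N] [Finite N] (f : N →* M),
    Function.Injective f → V M → V N
  of_surjective : ∀ (M N : Type v) [Monoid M] [Finite M] [Monoid N] [Finite N] (f : M →* N),
    Function.Surjective f → V M → V N

theorem DivisorClosed.quotient_of_surjective {V : MonoidClass.{v}} (hV : DivisorClosed V)
    [Finite M] [Finite N] {f : M →* N} (hf : Function.Surjective f) (c : Con M) (d : Con N)
    (h : ∀ x y, c x y → d (f x) (f y)) (hc : V c.Quotient) : V d.Quotient := by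
  refine hV.of_surjective _ _ (c.lift (d.mk'.comp f) fun x y hxy => ?_) ?_ hc
  · exact (Con.eq d).2 (h x y hxy)
  · intro z
    obtain ⟨y, rfl⟩ := Con.mk'_surjective z
    obtain ⟨x, rfl⟩ := hf y
    exact ⟨c.mk' x, rfl⟩

/-- `N` modulo the pullback of `c` embeds into `M / c` and maps onto `N / d`. -/
theorem DivisorClosed.quotient_of_injective {V : MonoidClass.{v}} (hV : DivisorClosed V)
    [Finite M] [Finite N] {f : N →* M} (c : Con M) (d : Con N)
    (h : ∀ x y, c (f x) (f y) → d x y) (hc : V c.Quotient) : V d.Quotient := by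
  have h1 : V (Con.ker (c.mk'.comp f)).Quotient :=
    hV.of_injective _ _ (Con.kerLift (c.mk'.comp f)) (Con.kerLift_injective _) hc
  refine hV.quotient_of_surjective (f := MonoidHom.id N) Function.surjective_id _ d
    (fun x y hxy => h x y ((Con.eq c).1 hxy)) h1

theorem divisorClosed_malcevK {V : MonoidClass.{v}} (hV : DivisorClosed V) :
    DivisorClosed (MalcevK V) where
  of_injective _ _ _ _ _ _ _ hf h :=
    hV.quotient_of_injective (KCon _) (KCon _) (fun _ _ h => KRel.of_injective hf h) h
  of_surjective _ _ _ _ _ _ _ hf h :=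
    hV.quotient_of_surjective hf (KCon _) (KCon _) (fun _ _ h => KRel.map hf h) h

theorem divisorClosed_malcevD {V : MonoidClass.{v}} (hV : DivisorClosed V) :
    DivisorClosed (MalcevD V) where
  of_injective _ _ _ _ _ _ _ hf h :=
    hV.quotient_of_injective (DCon _) (DCon _) (fun _ _ h => DRel.of_injective hf h) h
  of_surjective _ _ _ _ _ _ _ hf h :=
    hV.quotient_of_surjective hf (DCon _) (DCon _) (fun _ _ h => DRel.map hf h) h

theorem divisorClosed_jTrivial : DivisorClosed.{v} (fun M _ _ => JTrivial M) where
  of_injective _ _ _ _ _ _ _ hf h := h.of_injective hf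
  of_surjective _ _ _ _ _ _ _ hf h := h.of_surjective hf

theorem divisorClosed_class (m : ℕ) :
    DivisorClosed (ClassR.{v} (m + 1)) ∧ DivisorClosed (ClassL.{v} (m + 1)) := by
  induction m with
  | zero =>
    constructor
    · rw [zero_add, ClassR]; exact divisorClosed_jTrivial
    · rw [zero_add, ClassL]; exact divisorClosed_jTrivial
  | succ m ih =>
    constructor
    · rw [ClassR]; exact divisorClosed_malcevK ih.2
    · rw [ClassL]; exact divisorClosed_malcevD ih.1

/-! ### The variety `DA` -/

/-- For every idempotent `e`, products of elements `J`-above `e` satisfy `e x e = e`. -/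
def IsDA (M : Type v) [Monoid M] : Prop :=
  ∀ e : M, IsIdempotentElem e → ∀ x ∈ Submonoid.closure {y : M | JLe e y}, e * x * e = e

/-- Here `e` absorbs each generator: `e = p x q` gives `e = e p (x q)`, so `e p = e`, and then `e x
= e`. -/
theorem JTrivial.isDA (h : JTrivial M) : IsDA M := by
  intro e he x hx
  have key : e * x = e := by
    induction hx using Submonoid.closure_induction with
    | mem x hx =>
      obtain ⟨p, q, hpq⟩ := hx
      have h0 : e = e * p * (x * q) := by
        conv_lhs => rw [← he.eq]
        conv_lhs => rw [hpq]
        rw [← hpq, mul_assoc, ← mul_assoc p, ← hpq]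
      have h1 : e * p = e := h _ _ (.mul_right _ _) ⟨1, x * q, by rw [one_mul, ← h0]⟩
      rw [h1] at h0
      exact h _ _ (.mul_right _ _) ⟨1, q, by rw [one_mul, mul_assoc, ← h0]⟩
    | one => exact mul_one e
    | mul x y _ _ hx hy => rw [← mul_assoc, hx, hy]
  rw [key, he.eq]

theorem IsDA.map_mem_closure (f : M →* N) {e x : M}
    (hx : x ∈ Submonoid.closure {y : M | JLe e y}) :
    f x ∈ Submonoid.closure {y : N | JLe (f e) y} := by
  induction hx using Submonoid.closure_induction with
  | mem x hx => exact Submonoid.subset_closure (hx.map f)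
  | one => simp
  | mul x y _ _ hx hy => rw [map_mul]; exact mul_mem hx hy

theorem not_jLt_self (e : M) : ¬ JLt e e := fun h => h.2 h.1

/-- The identity `e x e = e` holds in the quotient; testing it at `e` itself excludes the
alternative `e <_J e`, so it holds in `M`. -/
theorem isDA_of_kCon [Finite M] (h : IsDA (KCon M).Quotient) : IsDA M := by
  intro e he x hx
  have h1 := h _ (he.map (KCon M).mk') _ (IsDA.map_mem_closure (KCon M).mk' hx)
  rw [← map_mul, ← map_mul] at h1
  rcases (Con.eq (KCon M)).1 h1 e he with h2 | h2
  · rw [he.eq] at h2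
    exact absurd h2.2 (not_jLt_self e)
  · simpa only [← mul_assoc, he.eq] using h2

theorem isDA_of_dCon [Finite M] (h : IsDA (DCon M).Quotient) : IsDA M := by
  intro e he x hx
  have h1 := h _ (he.map (DCon M).mk') _ (IsDA.map_mem_closure (DCon M).mk' hx)
  rw [← map_mul, ← map_mul] at h1
  rcases (Con.eq (DCon M)).1 h1 e he with h2 | h2
  · rw [he.eq] at h2
    exact absurd h2.2 (not_jLt_self e)
  · simpa only [mul_assoc, he.eq] using h2

theorem isDA_of_class (m : ℕ) : ∀ (M : Type v) [Monoid M] [Finite M],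
    (ClassR (m + 1) M → IsDA M) ∧ (ClassL (m + 1) M → IsDA M) := by
  induction m with
  | zero =>
    intro M _ _
    rw [zero_add, ClassR, ClassL]
    exact ⟨JTrivial.isDA, JTrivial.isDA⟩
  | succ m ih =>
    intro M _ _
    rw [ClassR, ClassL]
    exact ⟨fun h => isDA_of_kCon ((ih _).2 h), fun h => isDA_of_dCon ((ih _).1 h)⟩

-- Stabilising idempotents and exchange in stable contexts

/-- If `p` and `p w` are `R`-equivalent, then `p` is fixed by an idempotent `J`-below `w`. -/
theorem exists_idem_fix_right [Finite M] {p w z : M} (h : p * w * z = p) :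
    ∃ e : M, IsIdempotentElem e ∧ p * e = p ∧ ∃ t, e = w * t := by
  obtain ⟨k, hk, hi⟩ := exists_idem_pow (w * z)
  refine ⟨_, hi, ?_, ?_⟩
  · clear hi hk
    induction k with
    | zero => simp
    | succ k ih => rw [pow_succ', ← mul_assoc, ← mul_assoc, h, ih]
  · obtain ⟨j, rfl⟩ : ∃ j, k = j + 1 := ⟨k - 1, by omega⟩
    exact ⟨z * (w * z) ^ j, by rw [pow_succ', mul_assoc]⟩

theorem exists_idem_fix_left [Finite M] {q w z : M} (h : z * (w * q) = q) :
    ∃ e : M, IsIdempotentElem e ∧ e * q = q ∧ ∃ t, e = t * w := by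
  obtain ⟨k, hk, hi⟩ := exists_idem_pow (z * w)
  refine ⟨_, hi, ?_, ?_⟩
  · clear hi hk
    induction k with
    | zero => simp
    | succ k ih => rw [pow_succ, mul_assoc, mul_assoc, h, ih]
  · obtain ⟨j, rfl⟩ : ∃ j, k = j + 1 := ⟨k - 1, by omega⟩
    exact ⟨(z * w) ^ j * z, by rw [pow_succ, mul_assoc]⟩

/-- If `x ∼_K y` and `p`, `p x` are `R`-equivalent, then `p x = p y`. -/
theorem KRel.mul_eq_of_stable [Finite M] {p x y z : M} (h : KRel x y) (hp : p * x * z = p) :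
    p * x = p * y := by
  obtain ⟨e, he, hpe, t, rfl⟩ := exists_idem_fix_right hp
  rcases h _ he with h1 | h1
  -- The idempotent is `e = x t`, so `e x t = e` and `e x` cannot drop below `e`.
  · refine absurd ?_ h1.1.2
    exact ⟨1, t, by rw [one_mul, mul_assoc (x * t), he.eq]⟩
  · rw [← hpe, mul_assoc p, h1, mul_assoc p (x * t) y]

theorem DRel.mul_eq_of_stable [Finite M] {q x y z : M} (h : DRel x y) (hq : z * (x * q) = q) :
    x * q = y * q := by
  obtain ⟨e, he, hqe, t, rfl⟩ := exists_idem_fix_left hq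
  rcases h _ he with h1 | h1
  · refine absurd ?_ h1.1.2
    exact ⟨t, 1, by rw [mul_one, ← mul_assoc, he.eq]⟩
  · rw [← hqe, ← mul_assoc, h1, mul_assoc]

theorem IsDA.mul_fix_right (hM : IsDA M) {p e c : M} (he : IsIdempotentElem e) (hp : p * e = p)
    (hc : c ∈ Submonoid.closure {y : M | JLe e y}) : p * c * e = p := by
  conv_lhs => rw [← hp]
  rw [mul_assoc p, mul_assoc p, hM e he c hc, hp]

theorem IsDA.mul_fix_left (hM : IsDA M) {q e c : M} (he : IsIdempotentElem e) (hq : e * q = q)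
    (hc : c ∈ Submonoid.closure {y : M | JLe e y}) : e * (c * q) = q := by
  conv_lhs => rw [← hq]
  rw [← mul_assoc, ← mul_assoc, hM e he c hc, hq]

/-- The members of `R_2` are `R`-trivial. -/
theorem mul_eq_of_classR_two [Finite M] (h : ClassR 2 M) {p x z : M} (hp : p * x * z = p) :
    p * x = p := by
  obtain ⟨e, he, hpe, t, rfl⟩ := exists_idem_fix_right hp
  rw [ClassR] at h
  have hJ : JTrivial (KCon M).Quotient := by
    have h' : ClassL 1 (KCon M).Quotient := h
    rwa [ClassL] at h'
  -- With `e = x t`, the elements `e x` and `e` are `J`-equivalent, hence equal modulo `∼_K`;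
  -- testing at `e` yields `e x = e`.
  have h1 : (KCon M).mk' (x * t * x) = (KCon M).mk' (x * t) :=
    hJ _ _ (JLe.map _ (.mul_right _ _)) (JLe.map _ ⟨1, t, by
      rw [one_mul, mul_assoc (x * t), he.eq]⟩)
  rcases (Con.eq (KCon M)).1 h1 _ he with h2 | h2
  · rw [he.eq] at h2
    exact absurd h2.2 (not_jLt_self _)
  · rw [← mul_assoc, he.eq] at h2
    rw [← hpe, mul_assoc, h2, hpe]

theorem mul_eq_of_classL_two [Finite M] (h : ClassL 2 M) {q x z : M} (hq : z * (x * q) = q) :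
    x * q = q := by
  obtain ⟨e, he, hqe, t, rfl⟩ := exists_idem_fix_left hq
  rw [ClassL] at h
  have hJ : JTrivial (DCon M).Quotient := by
    have h' : ClassR 1 (DCon M).Quotient := h
    rwa [ClassR] at h'
  have h1 : (DCon M).mk' (x * (t * x)) = (DCon M).mk' (t * x) :=
    hJ _ _ (JLe.map _ (.mul_left _ _)) (JLe.map _ ⟨t, 1, by
      rw [mul_one, ← mul_assoc t, he.eq]⟩)
  rcases (Con.eq (DCon M)).1 h1 _ he with h2 | h2
  · rw [he.eq] at h2
    exact absurd h2.2 (not_jLt_self _)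
  · rw [mul_assoc, he.eq] at h2
    rw [← hqe, ← mul_assoc, h2, hqe]

/-- The congruence induced on a submonoid by the two-sided contexts `p a _ b q`. -/
def contextCon (S : Submonoid M) (p q : M) : Con S where
  r x y := ∀ a b : S, p * a * x * (b * q) = p * a * y * (b * q)
  iseqv := ⟨fun _ _ _ => rfl, fun h a b => (h a b).symm, fun h h' a b => (h a b).trans (h' a b)⟩
  mul' {w x y z} h h' a b := by
    have h1 := h a (y * b)
    have h2 := h' (a * x) b
    simp only [Submonoid.coe_mul, mul_assoc] at h1 h2 ⊢
    rw [h1, h2]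

/-- If `p` is `R`-stable and `q` is `L`-stable under the submonoid `S`, then both `∼_K` and `∼_D`
may be applied between `p` and `q`. -/
theorem sup_le_contextCon [Finite M] (hM : IsDA M) {S : Submonoid M} {p q e f : M}
    (he : IsIdempotentElem e) (hp : p * e = p) (hf : IsIdempotentElem f) (hq : f * q = q)
    (hSe : S ≤ Submonoid.closure {y : M | JLe e y})
    (hSf : S ≤ Submonoid.closure {y : M | JLe f y}) :
    (KCon M).comap S.subtype (fun _ _ => rfl) ⊔ (DCon M).comap S.subtype (fun _ _ => rfl) ≤
      contextCon S p q := by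
  refine sup_le (fun {x y} h a b => ?_) (fun {x y} h a b => ?_)
  -- Stability holds at `p a` and not only at `p`: by DA, `p a x e = p`, so `e a` leads back from `p
  -- a x` to `p a`.
  · have h1 : KRel (x : M) (y : M) := h
    rw [h1.mul_eq_of_stable (p := p * a) (z := e * a)]
    rw [← mul_assoc, mul_assoc p, hM.mul_fix_right he hp (mul_mem (hSe a.2) (hSe x.2))]
  · have h1 : DRel (x : M) (y : M) := h
    have h2 : b * f * (x * (b * q)) = b * q := by
      rw [← mul_assoc (x : M), mul_assoc b.1,
        hM.mul_fix_left hf hq (mul_mem (hSf x.2) (hSf b.2))]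
    rw [mul_assoc, mul_assoc, h1.mul_eq_of_stable h2, ← mul_assoc p]
    simp only [mul_assoc]

/-- Between stable contexts it suffices to compare elements modulo `∼_K ∨ ∼_D`. -/
theorem mul_eq_of_sup_rel [Finite M] (hM : IsDA M) {S : Submonoid M} {p q e f : M}
    (he : IsIdempotentElem e) (hp : p * e = p) (hf : IsIdempotentElem f) (hq : f * q = q)
    (hSe : S ≤ Submonoid.closure {y : M | JLe e y})
    (hSf : S ≤ Submonoid.closure {y : M | JLe f y}) {x y : S}
    (h : ((KCon M).comap S.subtype (fun _ _ => rfl) ⊔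
      (DCon M).comap S.subtype (fun _ _ => rfl) : Con S) x y) :
    p * x * q = p * y * q := by
  have := sup_le_contextCon hM he hp hf hq hSe hSf h 1 1
  simpa using this

/-- The roles cross over: the join contains `∼_D`, whose quotient is in the lower R-class, and
contains `∼_K`, whose quotient is in the lower L-class. Closure under divisors gives both
memberships. -/
theorem class_sup_quotient [Finite M] {m : ℕ} (hR : ClassR (m + 2) M) (hL : ClassL (m + 2) M)
    (S : Submonoid M) :
    ClassR (m + 1) ((KCon M).comap S.subtype (fun _ _ => rfl) ⊔
      (DCon M).comap S.subtype (fun _ _ => rfl) : Con S).Quotient ∧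
    ClassL (m + 1) ((KCon M).comap S.subtype (fun _ _ => rfl) ⊔
      (DCon M).comap S.subtype (fun _ _ => rfl) : Con S).Quotient := by
  rw [ClassR] at hR
  rw [ClassL] at hL
  have hc := divisorClosed_class.{v} m
  refine ⟨hc.1.quotient_of_injective (f := S.subtype) (DCon M) _ (fun x y h => ?_) hL,
    hc.2.quotient_of_injective (f := S.subtype) (KCon M) _ (fun x y h => ?_) hR⟩
  · exact (le_sup_right : (DCon M).comap S.subtype (fun _ _ => rfl) ≤ _) h
  · exact (le_sup_left : (KCon M).comap S.subtype (fun _ _ => rfl) ≤ _) h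

end Algebra

/-! ### Evaluation of rankers -/

section Rankers

variable {A : Type u} [DecidableEq A]

theorem minPos_eq_some {S : Finset ℕ} {k : ℕ} : minPos S = some k ↔ k ∈ S ∧ ∀ y ∈ S, k ≤ y := by
  unfold minPos
  split_ifs with h
  · rw [Option.some_inj]
    constructor
    · rintro rfl
      exact ⟨S.min'_mem h, fun y hy => S.min'_le y hy⟩
    · exact fun hk => le_antisymm (S.min'_le k hk.1) (hk.2 _ (S.min'_mem h))
  · simp only [false_iff]
    exact fun hk => h ⟨k, hk.1⟩

theorem maxPos_eq_some {S : Finset ℕ} {k : ℕ} : maxPos S = some k ↔ k ∈ S ∧ ∀ y ∈ S, y ≤ k := by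
  unfold maxPos
  split_ifs with h
  · rw [Option.some_inj]
    constructor
    · rintro rfl
      exact ⟨S.max'_mem h, fun y hy => S.le_max' y hy⟩
    · exact fun hk => le_antisymm (hk.2 _ (S.max'_mem h)) (S.le_max' k hk.1)
  · simp only [false_iff]
    exact fun hk => h ⟨k, hk.1⟩

theorem lt_length_of_getElem?_eq_some {w : List A} {i : ℕ} {a : A} (h : w[i]? = some a) :
    i < w.length := by
  by_contra hc
  rw [List.getElem?_eq_none (not_lt.1 hc)] at h
  cases h

theorem mem_positions {w : List A} {a : A} {y : ℕ} :
    y ∈ positions w a ↔ 0 < y ∧ w[y - 1]? = some a := by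
  rw [positions, Finset.mem_filter, Finset.mem_Icc]
  constructor
  · exact fun h => ⟨h.1.1, h.2⟩
  · intro h
    have := lt_length_of_getElem?_eq_some h.2
    exact ⟨⟨h.1, by omega⟩, h.2⟩

theorem step_X_eq_some {w : List A} {x k : ℕ} {a : A} :
    (Modality.X a).step w x = some k ↔
      x < k ∧ w[k - 1]? = some a ∧ ∀ y, x < y → y < k → w[y - 1]? ≠ some a := by
  rw [Modality.step, minPos_eq_some]
  simp only [Finset.mem_filter, mem_positions]
  constructor
  · rintro ⟨⟨⟨_, h1⟩, h2⟩, h3⟩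
    refine ⟨h2, h1, fun y hy hyk ha => ?_⟩
    have := h3 y ⟨⟨by omega, ha⟩, hy⟩
    omega
  · rintro ⟨h1, h2, h3⟩
    refine ⟨⟨⟨by omega, h2⟩, h1⟩, fun y hy => ?_⟩
    by_contra hc
    exact h3 y hy.2 (by omega) hy.1.2

theorem step_Y_eq_some {w : List A} {x k : ℕ} {a : A} :
    (Modality.Y a).step w x = some k ↔
      0 < k ∧ k < x ∧ w[k - 1]? = some a ∧ ∀ y, k < y → y < x → w[y - 1]? ≠ some a := by
  rw [Modality.step, maxPos_eq_some]
  simp only [Finset.mem_filter, mem_positions]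
  constructor
  · rintro ⟨⟨⟨h0, h1⟩, h2⟩, h3⟩
    refine ⟨h0, h2, h1, fun y hy hyk ha => ?_⟩
    have := h3 y ⟨⟨by omega, ha⟩, hyk⟩
    omega
  · rintro ⟨h0, h1, h2, h3⟩
    refine ⟨⟨⟨h0, h2⟩, h1⟩, fun y hy => ?_⟩
    by_contra hc
    exact h3 y (by omega) hy.2 hy.1.2

/-- The letter of a modality. -/
def Modality.letter : Modality A → A
  | .X a => a
  | .Y a => a

theorem getElem?_of_step {w : List A} {x k : ℕ} {Z : Modality A} (h : Z.step w x = some k) :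
    0 < k ∧ w[k - 1]? = some Z.letter := by
  cases Z with
  | X a => rw [step_X_eq_some] at h; exact ⟨by omega, h.2.1⟩
  | Y a => rw [step_Y_eq_some] at h; exact ⟨h.1, h.2.2.1⟩

theorem le_length_of_step {w : List A} {x k : ℕ} {Z : Modality A} (h : Z.step w x = some k) :
    0 < k ∧ k ≤ w.length := by
  have h1 := getElem?_of_step h
  have := lt_length_of_getElem?_eq_some h1.2
  omega

theorem evalFrom_append (w : List A) (r s : List (Modality A)) (x : ℕ) :
    evalFrom w (r ++ s) x = (evalFrom w r x).bind (evalFrom w s) := by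
  induction r generalizing x with
  | nil => rfl
  | cons Z r ih =>
    rw [List.cons_append, evalFrom, evalFrom, Option.bind_assoc]
    exact congrArg _ (funext ih)

theorem evalFrom_singleton (w : List A) (Z : Modality A) (x : ℕ) :
    evalFrom w [Z] x = Z.step w x := by
  rw [evalFrom]
  exact Option.bind_fun_some _

theorem evalFrom_concat_eq_some {w : List A} {r : List (Modality A)} {Z : Modality A} {x k : ℕ} :
    evalFrom w (r ++ [Z]) x = some k ↔ ∃ i, evalFrom w r x = some i ∧ Z.step w i = some k := by
  rw [evalFrom_append, Option.bind_eq_some_iff]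
  simp only [evalFrom_singleton]

theorem getElem?_of_evalFrom {w : List A} {r : List (Modality A)} {Z : Modality A} {x k : ℕ}
    (h : evalFrom w (r ++ [Z]) x = some k) : 0 < k ∧ w[k - 1]? = some Z.letter := by
  obtain ⟨i, _, h⟩ := evalFrom_concat_eq_some.1 h
  exact getElem?_of_step h

theorem evalFrom_range {w : List A} {r : List (Modality A)} {x k : ℕ} (hr : r ≠ [])
    (h : evalFrom w r x = some k) : 0 < k ∧ k ≤ w.length := by
  rw [← List.dropLast_append_getLast hr] at h
  obtain ⟨i, _, h⟩ := evalFrom_concat_eq_some.1 h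
  exact le_length_of_step h

theorem evalFrom_X_lt {w : List A} {r : List (Modality A)} {x k : ℕ} (hr : r ≠ [])
    (hX : ∀ Z ∈ r, Z.isX = true) (h : evalFrom w r x = some k) : x < k := by
  induction r generalizing x with
  | nil => exact absurd rfl hr
  | cons Z r ih =>
    rw [evalFrom, Option.bind_eq_some_iff] at h
    obtain ⟨i, hi, h⟩ := h
    have hxi : x < i := by
      cases Z with
      | X a => exact (step_X_eq_some.1 hi).1
      | Y a => simpa [Modality.isX] using hX _ List.mem_cons_self
    by_cases hr' : r = []
    · subst hr'
      rw [evalFrom, Option.some_inj] at h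
      omega
    · exact hxi.trans (ih hr' (fun Z hZ => hX Z (List.mem_cons_of_mem _ hZ)) h)

theorem evalFrom_Y_lt {w : List A} {r : List (Modality A)} {x k : ℕ} (hr : r ≠ [])
    (hY : ∀ Z ∈ r, Z.isX = false) (h : evalFrom w r x = some k) : k < x := by
  induction r generalizing x with
  | nil => exact absurd rfl hr
  | cons Z r ih =>
    rw [evalFrom, Option.bind_eq_some_iff] at h
    obtain ⟨i, hi, h⟩ := h
    have hxi : i < x := by
      cases Z with
      | X a => simpa [Modality.isX] using hY _ List.mem_cons_self
      | Y a => exact (step_Y_eq_some.1 hi).2.1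
    by_cases hr' : r = []
    · subst hr'
      rw [evalFrom, Option.some_inj] at h
      omega
    · exact (ih hr' (fun Z hZ => hY Z (List.mem_cons_of_mem _ hZ)) h).trans hxi

/-! ### Blocks -/

theorem blocks_cons_cons (Z W : Modality A) (s : List (Modality A)) :
    blocks (Z :: W :: s) = blocks (W :: s) + (if Z.isX = W.isX then 0 else 1) := rfl

theorem blocks_append_le {b : Bool} {ρ : List (Modality A)} (hρ : ∀ Z ∈ ρ, Z.isX = b)
    (W : Modality A) (s : List (Modality A)) :
    blocks (ρ ++ W :: s) ≤ blocks (W :: s) + (if b = W.isX then 0 else 1) := by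
  induction ρ with
  | nil => simp
  | cons Z ρ ih =>
    have h1 := ih fun Z hZ => hρ Z (List.mem_cons_of_mem _ hZ)
    have hZ := hρ Z List.mem_cons_self
    cases ρ with
    | nil => simp only [List.cons_append, List.nil_append, blocks_cons_cons, hZ]; exact le_rfl
    | cons V ρ =>
      have hV := hρ V (by simp)
      simp only [List.cons_append] at h1 ⊢
      rw [blocks_cons_cons, hZ, hV, if_pos rfl]
      exact h1

theorem blocks_le_one {b : Bool} {ρ : List (Modality A)} (hρ : ∀ Z ∈ ρ, Z.isX = b) :
    blocks ρ ≤ 1 := by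
  rcases List.eq_nil_or_concat ρ with rfl | ⟨ρ, W, rfl⟩
  · simp [blocks]
  · rw [List.concat_eq_append] at hρ ⊢
    have h := blocks_append_le (fun Z hZ => hρ Z (List.mem_append_left _ hZ)) W []
    rwa [if_pos (hρ W (by simp)).symm] at h

theorem blocks_le_concat (r : List (Modality A)) (Z : Modality A) :
    blocks r ≤ blocks (r ++ [Z]) := by
  induction r with
  | nil => simp [blocks]
  | cons W r ih =>
    cases r with
    | nil => simp [blocks]
    | cons V r =>
      simp only [List.cons_append, blocks_cons_cons] at ih ⊢
      omega

/-! ### The relation `≡_{m,n}` -/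

theorem ord_eq_none_left (o : Option ℕ) : ord none o = none := by cases o <;> rfl

theorem ord_eq_none_right (o : Option ℕ) : ord o none = none := by cases o <;> rfl

theorem ord_swap (o o' : Option ℕ) : ord o o' = (ord o' o).map Ordering.swap := by
  cases o <;> cases o' <;> simp [ord, Nat.compare_swap]

variable {m n : ℕ} {w w' : List A}

theorem RankerEquiv.symm (h : RankerEquiv m n w w') : RankerEquiv m n w' w where
  defined r hr := (h.defined r hr).symm
  ord_XY r hr s hs := (h.ord_XY r hr s hs).symm
  ord_YX r hr s hs := (h.ord_YX r hr s hs).symm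
  ord_XX r hr s hs := (h.ord_XX r hr s hs).symm
  ord_YY r hr s hs := (h.ord_YY r hr s hs).symm

theorem Rankers.mono {m n n' : ℕ} (h : n' ≤ n) : Rankers A m n' ⊆ Rankers A m n :=
  fun _ hr => ⟨hr.1, hr.2.1.trans h, hr.2.2⟩

theorem RankersX.mono {m n n' : ℕ} (h : n' ≤ n) : RankersX A m n' ⊆ RankersX A m n :=
  fun _ hr => ⟨Rankers.mono h hr.1, hr.2⟩

theorem RankersY.mono {m n n' : ℕ} (h : n' ≤ n) : RankersY A m n' ⊆ RankersY A m n :=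
  fun _ hr => ⟨Rankers.mono h hr.1, hr.2⟩

theorem RankerEquiv.mono {n' : ℕ} (h : RankerEquiv m n w w') (hn : n' ≤ n) :
    RankerEquiv m n' w w' where
  defined r hr := h.defined r (Rankers.mono hn hr)
  ord_XY r hr s hs := h.ord_XY r (RankersX.mono hn hr) s (RankersY.mono (by omega) hs)
  ord_YX r hr s hs := h.ord_YX r (RankersY.mono hn hr) s (RankersX.mono (by omega) hs)
  ord_XX r hr s hs := h.ord_XX r (RankersX.mono hn hr) s (RankersX.mono (by omega) hs)
  ord_YY r hr s hs := h.ord_YY r (RankersY.mono hn hr) s (RankersY.mono (by omega) hs)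

theorem RankerEquiv.ord_eq_of_blocks_le (h : RankerEquiv m n w w') {Z W : Modality A}
    {r s : List (Modality A)} (hr : (Z :: r).length ≤ n - 1) (hs : (W :: s).length ≤ n - 1)
    (hbr : blocks (Z :: r) ≤ m) (hbs : blocks (W :: s) ≤ m)
    (hc : Z.isX ≠ W.isX ∨ blocks (W :: s) ≤ m - 1) :
    ord (eval w (Z :: r)) (eval w (W :: s)) = ord (eval w' (Z :: r)) (eval w' (W :: s)) := by
  have hrn : (Z :: r).length ≤ n := hr.trans (Nat.sub_le _ _)
  cases Z with
  | X a =>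
    cases W with
    | X b =>
      exact h.ord_XX _ ⟨⟨List.cons_ne_nil _ _, hrn, hbr⟩, a, r, rfl⟩ _
        ⟨⟨List.cons_ne_nil _ _, hs, hc.resolve_left (fun hc => hc rfl)⟩, b, s, rfl⟩
    | Y b =>
      exact h.ord_XY _ ⟨⟨List.cons_ne_nil _ _, hrn, hbr⟩, a, r, rfl⟩ _
        ⟨⟨List.cons_ne_nil _ _, hs, hbs⟩, b, s, rfl⟩
  | Y a =>
    cases W with
    | X b =>
      exact h.ord_YX _ ⟨⟨List.cons_ne_nil _ _, hrn, hbr⟩, a, r, rfl⟩ _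
        ⟨⟨List.cons_ne_nil _ _, hs, hbs⟩, b, s, rfl⟩
    | Y b =>
      exact h.ord_YY _ ⟨⟨List.cons_ne_nil _ _, hrn, hbr⟩, a, r, rfl⟩ _
        ⟨⟨List.cons_ne_nil _ _, hs, hc.resolve_left (fun hc => hc rfl)⟩, b, s, rfl⟩

/-- Bounding both depths by `n - 1` lets either ranker play the shorter role, which removes the
asymmetry of the definition. -/
theorem RankerEquiv.ord_eq (h : RankerEquiv m n w w') {Z W : Modality A}
    {r s : List (Modality A)} (hr : (Z :: r).length ≤ n - 1) (hs : (W :: s).length ≤ n - 1)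
    (hbr : blocks (Z :: r) ≤ m) (hbs : blocks (W :: s) ≤ m)
    (hc : Z.isX ≠ W.isX ∨ blocks (Z :: r) ≤ m - 1 ∨ blocks (W :: s) ≤ m - 1) :
    ord (eval w (Z :: r)) (eval w (W :: s)) = ord (eval w' (Z :: r)) (eval w' (W :: s)) := by
  by_cases hc' : Z.isX ≠ W.isX ∨ blocks (W :: s) ≤ m - 1
  · exact h.ord_eq_of_blocks_le hr hs hbr hbs hc'
  · rw [ord_swap, h.ord_eq_of_blocks_le hs hr hbs hbr (by tauto), ← ord_swap]

/-! ### Factors -/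

/-- The factor of `w` strictly between the positions `x` and `y`. -/
def factor (w : List A) (x y : ℕ) : List A := (w.take (y - 1)).drop x

theorem factor_length {x y : ℕ} (hy : y ≤ w.length + 1) :
    (factor w x y).length = y - 1 - x := by
  rw [factor, List.length_drop, List.length_take, min_eq_left (by omega)]

theorem factor_getElem? {x y i : ℕ} {a : A} (hi : 0 < i) :
    (factor w x y)[i - 1]? = some a ↔ x + i < y ∧ w[x + i - 1]? = some a := by
  rw [factor, List.getElem?_drop, List.getElem?_take, show x + (i - 1) = x + i - 1 by omega]
  split_ifs with h
  · exact ⟨fun h' => ⟨by omega, h'⟩, And.right⟩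
  · simp only [false_iff]
    omega

/-- The bound `j ≤ y - x` admits both initial positions of the factor, its left end `0` and its
right end, one past its last letter. -/
theorem step_factor {x y j i : ℕ} (hj : j ≤ y - x) (Z : Modality A) :
    Z.step (factor w x y) j = some i ↔ Z.step w (x + j) = some (x + i) ∧ 0 < i ∧ x + i < y := by
  cases Z with
  | X a =>
    rw [step_X_eq_some, step_X_eq_some]
    constructor
    · rintro ⟨h1, h2, h3⟩
      obtain ⟨h4, h5⟩ := (factor_getElem? (by omega)).1 h2
      refine ⟨⟨by omega, h5, fun k hk hki ha => ?_⟩, by omega, h4⟩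
      refine h3 (k - x) (by omega) (by omega) ((factor_getElem? (by omega)).2 ⟨by omega, ?_⟩)
      rwa [show x + (k - x) = k by omega]
    · rintro ⟨⟨h1, h2, h3⟩, h4, h5⟩
      refine ⟨by omega, (factor_getElem? h4).2 ⟨h5, h2⟩, fun k hk hki ha => ?_⟩
      exact h3 (x + k) (by omega) (by omega) ((factor_getElem? (by omega)).1 ha).2
  | Y a =>
    rw [step_Y_eq_some, step_Y_eq_some]
    constructor
    · rintro ⟨h0, h1, h2, h3⟩
      obtain ⟨h4, h5⟩ := (factor_getElem? h0).1 h2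
      refine ⟨⟨by omega, by omega, h5, fun k hk hki ha => ?_⟩, h0, h4⟩
      refine h3 (k - x) (by omega) (by omega) ((factor_getElem? (by omega)).2 ⟨by omega, ?_⟩)
      rwa [show x + (k - x) = k by omega]
    · rintro ⟨⟨_, h1, h2, h3⟩, h4, h5⟩
      refine ⟨h4, by omega, (factor_getElem? h4).2 ⟨h5, h2⟩, fun k hk hki ha => ?_⟩
      exact h3 (x + k) (by omega) (by omega) ((factor_getElem? (by omega)).1 ha).2

theorem evalFrom_of_factor {x y j i : ℕ} (hj : j ≤ y - x) {r : List (Modality A)}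
    (h : evalFrom (factor w x y) r j = some i) :
    evalFrom w r (x + j) = some (x + i) ∧ i ≤ y - x ∧ (r ≠ [] → 0 < i ∧ x + i < y) := by
  induction r using List.reverseRecOn generalizing i with
  | nil =>
    rw [evalFrom, Option.some_inj] at h
    subst h
    exact ⟨rfl, hj, fun h => absurd rfl h⟩
  | append_singleton r Z ih =>
    obtain ⟨k, hk, h⟩ := evalFrom_concat_eq_some.1 h
    obtain ⟨h1, h2, -⟩ := ih hk
    obtain ⟨h3, h4, h5⟩ := (step_factor h2 Z).1 h
    exact ⟨evalFrom_concat_eq_some.2 ⟨_, h1, h3⟩, by omega, fun _ => ⟨h4, h5⟩⟩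

theorem evalFrom_factor_concat {x y j i k : ℕ} (hj : j ≤ y - x) {r : List (Modality A)}
    {Z : Modality A} (h : evalFrom (factor w x y) r j = some i)
    (h' : evalFrom w (r ++ [Z]) (x + j) = some k) (hxk : x < k) (hky : k < y) :
    evalFrom (factor w x y) (r ++ [Z]) j = some (k - x) := by
  obtain ⟨h1, h2, -⟩ := evalFrom_of_factor hj h
  obtain ⟨i', h3, h4⟩ := evalFrom_concat_eq_some.1 h'
  rw [h1, Option.some_inj] at h3
  subst h3
  refine evalFrom_concat_eq_some.2 ⟨i, h, (step_factor h2 Z).2 ⟨?_, by omega, by omega⟩⟩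
  rwa [show x + (k - x) = k by omega]

/-- Rankers defined on a factor of `w` are defined on the corresponding factor of `w'`, if the
same positions are reached, relative to the ends of the factors, on `w` and `w'`. -/
theorem evalFrom_factor_transfer {x y x' y' j j' : ℕ} (hj : j ≤ y - x) (hj' : j' ≤ y' - x')
    (P : List (Modality A) → Prop) (hP : ∀ r Z, P (r ++ [Z]) → P r)
    (H : ∀ r, r ≠ [] → P r → ∀ k, evalFrom w r (x + j) = some k → x < k → k < y →
      ∃ k', evalFrom w' r (x' + j') = some k' ∧ x' < k' ∧ k' < y')
    {r : List (Modality A)} (hr : P r) (h : (evalFrom (factor w x y) r j).isSome) :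
    (evalFrom (factor w' x' y') r j').isSome := by
  induction r using List.reverseRecOn with
  | nil => rfl
  | append_singleton r Z ih =>
    obtain ⟨k, hk⟩ := Option.isSome_iff_exists.1 h
    obtain ⟨h1, _, h3⟩ := evalFrom_of_factor hj hk
    obtain ⟨h3, h4⟩ := h3 (by simp)
    obtain ⟨k', h5, h6, h7⟩ := H _ (by simp) hr _ h1 (by omega) h4
    obtain ⟨i, hi, _⟩ := evalFrom_concat_eq_some.1 hk
    obtain ⟨i', hi'⟩ := Option.isSome_iff_exists.1
      (ih (hP r Z hr) (Option.isSome_iff_exists.2 ⟨i, hi⟩))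
    exact Option.isSome_iff_exists.2 ⟨_, evalFrom_factor_concat hj' hi' h5 h6 h7⟩

end Rankers

/-! ### Marked positions -/

section Marks

variable {A : Type u} [DecidableEq A] {m n : ℕ} {w w' : List A}

/-- The starting position of rankers: `0` if `b` is true, `|w| + 1` if `b` is false. -/
def startPos (b : Bool) (w : List A) : ℕ := if b then 0 else w.length + 1

theorem eval_cons (w : List A) (Z : Modality A) (r : List (Modality A)) :
    eval w (Z :: r) = evalFrom w (Z :: r) (startPos Z.isX w) := by
  cases Z <;> rfl

/-- The positions `x` of `w` and `x'` of `w'` reached by the one-block word `ρ` of modalities, where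
`ρ` is also allowed to be empty. -/
structure IsMark (w w' : List A) (N : ℕ) (b : Bool) (ρ : List (Modality A)) (x x' : ℕ) : Prop where
  isX_eq : ∀ Z ∈ ρ, Z.isX = b
  length_le : ρ.length ≤ N
  eval_left : evalFrom w ρ (startPos b w) = some x
  eval_right : evalFrom w' ρ (startPos b w') = some x'

theorem le_of_evalFrom_startPos {b : Bool} {ρ : List (Modality A)} {x : ℕ}
    (h : evalFrom w ρ (startPos b w) = some x) : x ≤ w.length + 1 := by
  by_cases hρ : ρ = []
  · subst hρ
    rw [evalFrom, Option.some_inj] at h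
    subst h
    unfold startPos
    split_ifs <;> omega
  · have := evalFrom_range hρ h
    omega

variable {N : ℕ} {b c : Bool} {ρ σ : List (Modality A)} {x x' y y' : ℕ}

/-- If `ρ` is empty, `Z` becomes the initial modality and determines the starting end itself; `h0`
makes this end agree with `b`. -/
theorem eval_append_of_start (h : evalFrom w ρ (startPos b w) = some x) {Z : Modality A}
    (hb : ∀ W ∈ ρ, W.isX = b) (h0 : ρ = [] → b = Z.isX) (r : List (Modality A)) :
    eval w (ρ ++ Z :: r) = evalFrom w (Z :: r) x := by
  cases ρ with
  | nil =>
    rw [evalFrom, Option.some_inj] at h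
    rw [List.nil_append, eval_cons, ← h0 rfl, h]
  | cons W ρ =>
    rw [List.cons_append, eval_cons, hb W List.mem_cons_self, ← List.cons_append, evalFrom_append,
      h, Option.bind_some]

theorem eval_of_start (h : evalFrom w ρ (startPos b w) = some x)
    (hb : ∀ W ∈ ρ, W.isX = b) (h0 : ρ ≠ []) : eval w ρ = some x := by
  cases ρ with
  | nil => exact absurd rfl h0
  | cons W ρ => rw [eval_cons, hb W List.mem_cons_self, h]

theorem append_cons_form (hb : ∀ W ∈ ρ, W.isX = b) {Z : Modality A} (h0 : ρ = [] → b = Z.isX)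
    (r : List (Modality A)) : ∃ W s, ρ ++ Z :: r = W :: s ∧ W.isX = b := by
  cases ρ with
  | nil => exact ⟨Z, r, rfl, (h0 rfl).symm⟩
  | cons W ρ => exact ⟨W, _, rfl, hb W List.mem_cons_self⟩

theorem compare_eq_iff {i j i' j' : ℕ} :
    compare i j = compare i' j' ↔ ((i < j ↔ i' < j') ∧ (j < i ↔ j' < i')) := by
  rcases lt_trichotomy i j with h | h | h <;> rcases lt_trichotomy i' j' with h' | h' | h' <;>
    simp [compare_lt_iff_lt.2, compare_gt_iff_gt.2, h, h', h.le, h'.le, not_lt.2]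

/-- The data of two consecutive marks. -/
structure IsMarkPair (w w' : List A) (N : ℕ) (b c : Bool) (ρ σ : List (Modality A))
    (x x' y y' : ℕ) : Prop where
  left : IsMark w w' N b ρ x x'
  right : IsMark w w' N c σ y y'
  lt : x < y
  lt' : x' < y'

theorem IsMark.symm (h : IsMark w w' N b ρ x x') : IsMark w' w N b ρ x' x :=
  ⟨h.isX_eq, h.length_le, h.eval_right, h.eval_left⟩

theorem IsMarkPair.symm (h : IsMarkPair w w' N b c ρ σ x x' y y') :
    IsMarkPair w' w N b c ρ σ x' x y' y :=
  ⟨h.left.symm, h.right.symm, h.lt', h.lt⟩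

-- Simulating rankers of a factor on the whole word

/-- The word of modalities of the end of the factor at which `Z` starts. -/
def sideWord (ρ σ : List (Modality A)) (Z : Modality A) : List (Modality A) :=
  if Z.isX then ρ else σ

/-- The direction at the end of the factor at which `Z` starts. -/
def sideDir (b c : Bool) (Z : Modality A) : Bool := if Z.isX then b else c

/-- The position at the end of the factor at which `Z` starts. -/
def sidePos (x y : ℕ) (Z : Modality A) : ℕ := if Z.isX then x else y

/-- An empty word marks an end of `w`. Since `x < y`, the left mark cannot be the right end, nor the
right mark the left end, so its direction is that of `Z`. -/
theorem IsMarkPair.side (h : IsMarkPair w w' N b c ρ σ x x' y y') (Z : Modality A) :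
    IsMark w w' N (sideDir b c Z) (sideWord ρ σ Z) (sidePos x y Z) (sidePos x' y' Z) ∧
    (sideWord ρ σ Z = [] → sideDir b c Z = Z.isX) := by
  unfold sideDir sideWord sidePos
  cases hZ : Z.isX with
  | true =>
    simp only [if_true]
    refine ⟨h.left, fun h0 => ?_⟩
    subst h0
    have h1 := h.left.eval_left
    have h2 := le_of_evalFrom_startPos h.right.eval_left
    have h3 := h.lt
    rw [evalFrom, Option.some_inj] at h1
    cases b with
    | true => rfl
    | false => simp [startPos] at h1; omega
  | false =>
    simp only [Bool.false_eq_true, if_false]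
    refine ⟨h.right, fun h0 => ?_⟩
    subst h0
    have h1 := h.right.eval_left
    have h3 := h.lt
    rw [evalFrom, Option.some_inj] at h1
    cases c with
    | false => rfl
    | true => simp [startPos] at h1; omega

theorem sideWord_blocks_le (h : IsMarkPair w w' N b c ρ σ x x' y y') (Z : Modality A)
    (r : List (Modality A)) :
    blocks (sideWord ρ σ Z ++ Z :: r) ≤
      blocks (Z :: r) + (if sideDir b c Z = Z.isX then 0 else 1) :=
  blocks_append_le (h.side Z).1.isX_eq Z r

/-- Prefixing each ranker by the mark it starts from gives rankers on the whole word, with at most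
`N` more modalities and one more block. The delicate case is that of two prefixed rankers starting
in the same direction, where one of them must have a block to spare. -/
theorem IsMarkPair.ord_evalFrom_eq (h : IsMarkPair w w' N b c ρ σ x x' y y') {n' : ℕ}
    (hE : RankerEquiv m n w w') (hm : 2 ≤ m) (hn : N + n' + 1 ≤ n) {Z W : Modality A}
    {r s : List (Modality A)} (hr : (Z :: r).length ≤ n') (hs : (W :: s).length ≤ n')
    (hbr : blocks (Z :: r) ≤ m - 1) (hbs : blocks (W :: s) ≤ m - 1)
    (hc : Z.isX ≠ W.isX ∨ blocks (W :: s) ≤ m - 2) :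
    ord (evalFrom w (Z :: r) (sidePos x y Z)) (evalFrom w (W :: s) (sidePos x y W)) =
      ord (evalFrom w' (Z :: r) (sidePos x' y' Z)) (evalFrom w' (W :: s) (sidePos x' y' W)) := by
  obtain ⟨hZ, hZ0⟩ := h.side Z
  obtain ⟨hW, hW0⟩ := h.side W
  have b1 := sideWord_blocks_le h Z r
  have b2 := sideWord_blocks_le h W s
  have l1 : (sideWord ρ σ Z ++ Z :: r).length ≤ n - 1 := by
    have := hZ.length_le
    rw [List.length_append]
    omega
  have l2 : (sideWord ρ σ W ++ W :: s).length ≤ n - 1 := by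
    have := hW.length_le
    rw [List.length_append]
    omega
  rw [← eval_append_of_start hZ.eval_left hZ.isX_eq hZ0,
    ← eval_append_of_start hZ.eval_right hZ.isX_eq hZ0,
    ← eval_append_of_start hW.eval_left hW.isX_eq hW0,
    ← eval_append_of_start hW.eval_right hW.isX_eq hW0]
  obtain ⟨Z', r', e1, d1⟩ := append_cons_form hZ.isX_eq hZ0 r
  obtain ⟨W', s', e2, d2⟩ := append_cons_form hW.isX_eq hW0 s
  rw [e1] at b1 l1 ⊢
  rw [e2] at b2 l2 ⊢
  refine hE.ord_eq l1 l2 (b1.trans (by split_ifs <;> omega)) (b2.trans (by split_ifs <;> omega)) ?_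
  rw [d1, d2]
  by_cases hd : sideDir b c Z = sideDir b c W
  · right
    rcases hc with hc | hc
    -- `Z` and `W` are opposite, so one of them agrees with the common direction of the marks and
    -- merges with its mark into one block.
    · by_cases h1 : sideDir b c Z = Z.isX
      · left
        rw [if_pos h1] at b1
        omega
      · right
        have h2 : sideDir b c W = W.isX := by
          rw [← hd]
          revert hc h1
          cases sideDir b c Z <;> cases Z.isX <;> cases W.isX <;> simp
        rw [if_pos h2] at b2
        omega
    · right
      split_ifs at b2 <;> omega
  · exact Or.inl hd

theorem IsMarkPair.isSome_evalFrom_iff (h : IsMarkPair w w' N b c ρ σ x x' y y') {n' : ℕ}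
    (hE : RankerEquiv m n w w') (hm : 2 ≤ m) (hn : N + n' + 1 ≤ n) {Z : Modality A}
    {r : List (Modality A)} (hr : (Z :: r).length ≤ n') (hbr : blocks (Z :: r) ≤ m - 1) :
    (evalFrom w (Z :: r) (sidePos x y Z)).isSome ↔
      (evalFrom w' (Z :: r) (sidePos x' y' Z)).isSome := by
  obtain ⟨hZ, hZ0⟩ := h.side Z
  have b1 := sideWord_blocks_le h Z r
  rw [← eval_append_of_start hZ.eval_left hZ.isX_eq hZ0,
    ← eval_append_of_start hZ.eval_right hZ.isX_eq hZ0]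
  refine hE.defined _ ⟨by simp, ?_, b1.trans (by split_ifs <;> omega)⟩
  have := hZ.length_le
  rw [List.length_append]
  omega

theorem ord_some_eq_iff {i j i' j' : ℕ} :
    ord (some i) (some j) = ord (some i') (some j') ↔
      ((i < j ↔ i' < j') ∧ (j < i ↔ j' < i')) := by
  rw [← compare_eq_iff]
  exact Option.some_inj

/-- Positions reached by rankers compare to marked positions in the same way on `w` and `w'`. -/
theorem IsMark.compare_iff {d : Bool} {τ : List (Modality A)} {t t' : ℕ}
    (ht : IsMark w w' N d τ t t') (hE : RankerEquiv m n w w') (hm : 1 ≤ m) (hn : N + 1 ≤ n)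
    {Z : Modality A} {r : List (Modality A)} (hc : d ≠ Z.isX ∨ 2 ≤ m) (hl : (Z :: r).length ≤ n - 1)
    (hb : blocks (Z :: r) ≤ m) {a a' : ℕ} (ha : eval w (Z :: r) = some a)
    (ha' : eval w' (Z :: r) = some a') : (a < t ↔ a' < t') ∧ (t < a ↔ t' < a') := by
  -- An empty mark is `0` or one past the last letter, outside the range of every ranker.
  by_cases h0 : τ = []
  · subst h0
    have h1 := ht.eval_left
    have h2 := ht.eval_right
    rw [evalFrom, Option.some_inj] at h1 h2
    have h3 := evalFrom_range (List.cons_ne_nil Z r) (eval_cons w Z r ▸ ha)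
    have h4 := evalFrom_range (List.cons_ne_nil Z r) (eval_cons w' Z r ▸ ha')
    cases d <;> simp [startPos] at h1 h2 <;> omega
  · have h1 := eval_of_start ht.eval_left ht.isX_eq h0
    have h2 := eval_of_start ht.eval_right ht.isX_eq h0
    rw [← ord_some_eq_iff, ← ha, ← ha', ← h1, ← h2]
    have hl2 := ht.length_le
    have hb2 := blocks_le_one ht.isX_eq
    cases τ with
    | nil => exact absurd rfl h0
    | cons W τ =>
      refine hE.ord_eq hl (by omega) hb (by omega) (hc.imp (fun hc => ?_) fun hc => Or.inr ?_)
      · rw [ht.isX_eq W List.mem_cons_self]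
        exact hc.symm
      · omega

theorem IsMarkPair.start_eq (h : IsMarkPair w w' N b c ρ σ x x' y y') (Z : Modality A) :
    Z.start (factor w x y) ≤ y - x ∧ x + Z.start (factor w x y) = sidePos x y Z := by
  have h1 := factor_length (le_of_evalFrom_startPos h.right.eval_left) (x := x)
  have h2 := h.lt
  cases Z with
  | X a => simp [Modality.start, sidePos, Modality.isX]
  | Y a => simp [Modality.start, sidePos, Modality.isX, h1]; omega

/-- A ranker evaluated in the factor lands strictly between the marks after each modality; comparing
each prefix with both marks carries this over to `w'`. -/
theorem IsMarkPair.eval_factor_isSome (h : IsMarkPair w w' N b c ρ σ x x' y y') {n' : ℕ}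
    (hE : RankerEquiv m n w w') (hm : 2 ≤ m) (hn : N + n' + 1 ≤ n) {Z : Modality A}
    {r : List (Modality A)} (hr : (Z :: r).length ≤ n') (hbr : blocks (Z :: r) ≤ m - 1)
    (hd : (eval (factor w x y) (Z :: r)).isSome) : (eval (factor w' x' y') (Z :: r)).isSome := by
  obtain ⟨j1, j2⟩ := h.start_eq Z
  obtain ⟨j1', j2'⟩ := h.symm.start_eq Z
  refine evalFrom_factor_transfer j1 j1'
    (fun s => s ≠ [] → (∃ t, s = Z :: t) ∧ s.length ≤ n' ∧ blocks s ≤ m - 1) ?_ ?_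
    (fun _ => ⟨⟨r, rfl⟩, hr, hbr⟩) hd
  · intro s W hs h0
    obtain ⟨⟨t, ht⟩, h2, h3⟩ := hs (by simp)
    refine ⟨?_, ?_, (blocks_le_concat s W).trans h3⟩
    · cases s with
      | nil => exact absurd rfl h0
      | cons V s =>
        rw [List.cons_append, List.cons.injEq] at ht
        exact ⟨s, by rw [ht.1]⟩
    · rw [List.length_append] at h2
      omega
  · intro s hs hP k hk hxk hky
    obtain ⟨⟨t, rfl⟩, hl, hb⟩ := hP hs
    rw [j2] at hk
    rw [j2']
    obtain ⟨k', hk'⟩ := Option.isSome_iff_exists.1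
      ((h.isSome_evalFrom_iff hE hm hn hl hb).1 (Option.isSome_iff_exists.2 ⟨k, hk⟩))
    refine ⟨k', hk', ?_⟩
    obtain ⟨hZ, hZ0⟩ := h.side Z
    have b1 := sideWord_blocks_le h Z t
    rw [← eval_append_of_start hZ.eval_left hZ.isX_eq hZ0] at hk
    rw [← eval_append_of_start hZ.eval_right hZ.isX_eq hZ0] at hk'
    have l1 : (sideWord ρ σ Z ++ Z :: t).length ≤ n - 1 := by
      have := hZ.length_le
      rw [List.length_append]
      omega
    obtain ⟨Z', r', e1, d1⟩ := append_cons_form hZ.isX_eq hZ0 t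
    rw [e1] at b1 l1 hk hk'
    have hb' : blocks (Z' :: r') ≤ m := b1.trans (by split_ifs <;> omega)
    exact ⟨(h.left.compare_iff hE (by omega) (by omega) (Or.inr hm) l1 hb' hk hk').2.1 hxk,
      (h.right.compare_iff hE (by omega) (by omega) (Or.inr hm) l1 hb' hk hk').1.1 hky⟩

theorem IsMarkPair.ord_factor_eq (h : IsMarkPair w w' N b c ρ σ x x' y y') {n' : ℕ}
    (hE : RankerEquiv m n w w') (hm : 2 ≤ m) (hn : N + n' + 1 ≤ n) {Z W : Modality A}
    {r s : List (Modality A)} (hr : (Z :: r).length ≤ n') (hs : (W :: s).length ≤ n')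
    (hbr : blocks (Z :: r) ≤ m - 1) (hbs : blocks (W :: s) ≤ m - 1)
    (hc : Z.isX ≠ W.isX ∨ blocks (W :: s) ≤ m - 2) :
    ord (eval (factor w x y) (Z :: r)) (eval (factor w x y) (W :: s)) =
      ord (eval (factor w' x' y') (Z :: r)) (eval (factor w' x' y') (W :: s)) := by
  have key : ∀ (V : Modality A) (t : List (Modality A)), (V :: t).length ≤ n' →
      blocks (V :: t) ≤ m - 1 →
      (eval (factor w x y) (V :: t) = none ∧ eval (factor w' x' y') (V :: t) = none) ∨
      ∃ i i', eval (factor w x y) (V :: t) = some i ∧ eval (factor w' x' y') (V :: t) = some i' ∧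
        evalFrom w (V :: t) (sidePos x y V) = some (x + i) ∧
        evalFrom w' (V :: t) (sidePos x' y' V) = some (x' + i') := by
    intro V t hl hb
    have h1 := h.eval_factor_isSome hE hm hn hl hb
    have h2 := h.symm.eval_factor_isSome hE.symm hm hn hl hb
    cases hi : eval (factor w x y) (V :: t) with
    | none =>
      cases hi' : eval (factor w' x' y') (V :: t) with
      | none => exact Or.inl ⟨rfl, rfl⟩
      | some i' => simp [hi, hi'] at h2
    | some i =>
      cases hi' : eval (factor w' x' y') (V :: t) with
      | none => simp [hi, hi'] at h1
      | some i' =>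
        obtain ⟨j1, j2⟩ := h.start_eq V
        obtain ⟨j1', j2'⟩ := h.symm.start_eq V
        exact Or.inr ⟨i, i', rfl, rfl, j2 ▸ (evalFrom_of_factor j1 hi).1,
          j2' ▸ (evalFrom_of_factor j1' hi').1⟩
  rcases key Z r hr hbr with ⟨h1, h2⟩ | ⟨i, i', h1, h2, h3, h4⟩
  · rw [h1, h2, ord_eq_none_left, ord_eq_none_left]
  · rcases key W s hs hbs with ⟨k1, k2⟩ | ⟨k, k', k1, k2, k3, k4⟩
    · rw [k1, k2, ord_eq_none_right, ord_eq_none_right]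
    · have h5 := h.ord_evalFrom_eq hE hm hn hr hs hbr hbs hc
      rw [h3, h4, k3, k4, ord_some_eq_iff] at h5
      rw [h1, h2, k1, k2, ord_some_eq_iff]
      omega

/-- Corresponding factors between marked positions are equivalent at the next lower level. -/
theorem IsMarkPair.factor_equiv (h : IsMarkPair w w' N b c ρ σ x x' y y') {n' : ℕ}
    (hE : RankerEquiv m n w w') (hm : 2 ≤ m) (hn : N + n' + 1 ≤ n) :
    RankerEquiv (m - 1) n' (factor w x y) (factor w' x' y') where
  defined := by
    rintro r ⟨h0, hl, hb⟩
    cases r with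
    | nil => exact absurd rfl h0
    | cons Z r => exact ⟨h.eval_factor_isSome hE hm hn hl hb,
        h.symm.eval_factor_isSome hE.symm hm hn hl hb⟩
  ord_XY := by
    rintro _ ⟨⟨-, hl, hb⟩, a, r, rfl⟩ _ ⟨⟨-, hl', hb'⟩, a', r', rfl⟩
    exact h.ord_factor_eq hE hm hn hl (hl'.trans (Nat.sub_le _ _)) hb hb'
      (Or.inl (by simp [Modality.isX]))
  ord_YX := by
    rintro _ ⟨⟨-, hl, hb⟩, a, r, rfl⟩ _ ⟨⟨-, hl', hb'⟩, a', r', rfl⟩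
    exact h.ord_factor_eq hE hm hn hl (hl'.trans (Nat.sub_le _ _)) hb hb'
      (Or.inl (by simp [Modality.isX]))
  ord_XX := by
    rintro _ ⟨⟨-, hl, hb⟩, a, r, rfl⟩ _ ⟨⟨-, hl', hb'⟩, a', r', rfl⟩
    exact h.ord_factor_eq hE hm hn hl (hl'.trans (Nat.sub_le _ _)) hb
      (hb'.trans (Nat.sub_le _ _)) (Or.inr (by omega))
  ord_YY := by
    rintro _ ⟨⟨-, hl, hb⟩, a, r, rfl⟩ _ ⟨⟨-, hl', hb'⟩, a', r', rfl⟩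
    exact h.ord_factor_eq hE hm hn hl (hl'.trans (Nat.sub_le _ _)) hb
      (hb'.trans (Nat.sub_le _ _)) (Or.inr (by omega))

/-- Equivalent words have the same letters. -/
theorem RankerEquiv.mem_iff (h : RankerEquiv m n w w') (hm : 1 ≤ m) (hn : 1 ≤ n) (a : A) :
    a ∈ w ↔ a ∈ w' := by
  have key : ∀ v : List A, (eval v [Modality.X a]).isSome ↔ a ∈ v := by
    intro v
    rw [eval, evalFrom_singleton, List.mem_iff_getElem?]
    constructor
    · intro hs
      obtain ⟨k, hk⟩ := Option.isSome_iff_exists.1 hs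
      exact ⟨_, (getElem?_of_step hk).2⟩
    · rintro ⟨i, hi⟩
      classical
      have hex : ∃ i : ℕ, v[i]? = some a := ⟨i, hi⟩
      refine Option.isSome_iff_exists.2 ⟨Nat.find hex + 1, step_X_eq_some.2 ⟨?_, ?_, ?_⟩⟩
      · simp [Modality.start]
      · exact Nat.find_spec hex
      · intro y hy hy' hc
        have := Nat.find_min' hex hc
        simp only [Modality.start] at hy
        omega
  rw [← key, ← key]
  exact h.defined _ ⟨by simp, by simpa using hn, by simpa [blocks] using hm⟩

end Marks

-- Relative order and letters of marks

section Order

variable {A : Type u} [DecidableEq A] {m n : ℕ} {w w' : List A}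
variable {N : ℕ} {b c : Bool} {ρ σ : List (Modality A)} {x x' y y' : ℕ}

/-- Marked positions obtained from one `X`-word and one `Y`-word are ordered in the same way. -/
theorem IsMark.lt_iff_of_ne (h : IsMark w w' N b ρ x x') (h' : IsMark w w' N c σ y y')
    (hE : RankerEquiv m n w w') (hm : 1 ≤ m) (hn : N + 1 ≤ n) (hbc : b ≠ c) :
    (x < y ↔ x' < y') ∧ (y < x ↔ y' < x') := by
  have key : ∀ {b c : Bool} {ρ σ : List (Modality A)} {x x' y y' : ℕ},
      IsMark w w' N b ρ x x' → IsMark w w' N c σ y y' → b ≠ c → ρ ≠ [] →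
      (x < y ↔ x' < y') ∧ (y < x ↔ y' < x') := by
    intro b c ρ σ x x' y y' h h' hbc h0
    have h1 := eval_of_start h.eval_left h.isX_eq h0
    have h2 := eval_of_start h.eval_right h.isX_eq h0
    have hl := h.length_le
    have hb := blocks_le_one h.isX_eq
    cases ρ with
    | nil => exact absurd rfl h0
    | cons W ρ =>
      refine h'.compare_iff hE hm hn (Or.inl ?_) (by omega) (by omega) h1 h2
      rw [h.isX_eq W List.mem_cons_self]
      exact hbc.symm
  by_cases h0 : ρ = []
  · by_cases h0' : σ = []
    · subst h0 h0'
      have h1 := h.eval_left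
      have h2 := h.eval_right
      have h3 := h'.eval_left
      have h4 := h'.eval_right
      rw [evalFrom, Option.some_inj] at h1 h2 h3 h4
      revert hbc
      cases b <;> cases c <;> simp [startPos] at h1 h2 h3 h4 ⊢ <;> omega
    · exact (key h' h hbc.symm h0').symm
  · exact key h h' hbc h0

/-- A nonempty one-block word moves strictly in its direction, so the order is forced in each word
separately. -/
theorem IsMark.lt_of_prefix (h : IsMark w w' N b ρ x x') (h' : IsMark w w' N b σ y y')
    (hp : ρ <+: σ) : (x < y ↔ x' < y') ∧ (y < x ↔ y' < x') := by
  obtain ⟨τ, rfl⟩ := hp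
  have h1 := h'.eval_left
  have h2 := h'.eval_right
  rw [evalFrom_append, h.eval_left, Option.bind_some] at h1
  rw [evalFrom_append, h.eval_right, Option.bind_some] at h2
  have hτ : ∀ Z ∈ τ, Z.isX = b := fun Z hZ => h'.isX_eq Z (List.mem_append_right _ hZ)
  by_cases h0 : τ = []
  · subst h0
    rw [evalFrom, Option.some_inj] at h1 h2
    omega
  · cases b with
    | true =>
      have := evalFrom_X_lt h0 hτ h1
      have := evalFrom_X_lt h0 hτ h2
      omega
    | false =>
      have := evalFrom_Y_lt h0 hτ h1
      have := evalFrom_Y_lt h0 hτ h2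
      omega

/-- Marked positions carry the same letter. -/
theorem IsMark.getElem?_eq (h : IsMark w w' N b ρ x x') (hx : 0 < x) :
    w[x - 1]? = w'[x' - 1]? := by
  rcases List.eq_nil_or_concat ρ with rfl | ⟨τ, Z, rfl⟩
  · have h1 := h.eval_left
    have h2 := h.eval_right
    rw [evalFrom, Option.some_inj] at h1 h2
    cases b <;> simp [startPos] at h1 h2
    · rw [← h1, ← h2]; simp
    · omega
  · have h1 := h.eval_left
    have h2 := h.eval_right
    rw [List.concat_eq_append] at h1 h2
    rw [(getElem?_of_evalFrom h1).2, (getElem?_of_evalFrom h2).2]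

end Order

/-! ### Descents -/

section Descents

variable {A : Type u} {M : Type v} [Monoid M] (φ : FreeMonoid A →* M)

/-- The image of a word, given as a list. -/
def wordVal (w : List A) : M := φ (FreeMonoid.ofList w)

theorem wordVal_nil : wordVal φ [] = 1 := map_one φ

theorem wordVal_append (w w' : List A) : wordVal φ (w ++ w') = wordVal φ w * wordVal φ w' :=
  map_mul φ _ _

theorem jLe_wordVal_of_mem {w : List A} {a : A} (h : a ∈ w) :
    JLe (wordVal φ w) (wordVal φ [a]) := by
  obtain ⟨s, t, rfl⟩ := List.append_of_mem h
  refine ⟨wordVal φ s, wordVal φ t, ?_⟩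
  rw [← wordVal_append, ← wordVal_append, List.append_assoc]
  rfl

theorem take_append_factor (w : List A) {x y : ℕ} (h : x < y) :
    w.take (y - 1) = w.take x ++ factor w x y := by
  rw [factor]
  conv_lhs => rw [← List.take_append_drop x (w.take (y - 1))]
  rw [List.take_take, min_eq_left (by omega)]

theorem factor_append_drop (w : List A) {x y : ℕ} (h : x < y) (hy : y ≤ w.length + 1) :
    w.drop x = factor w x y ++ w.drop (y - 1) := by
  rw [factor]
  conv_lhs => rw [← List.take_append_drop (y - 1) w]
  rw [List.drop_append_of_le_length]
  rw [List.length_take]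
  omega

theorem take_eq_take_pred_append (w : List A) {y : ℕ} (h : 0 < y) :
    w.take y = w.take (y - 1) ++ w[y - 1]?.toList := by
  conv_lhs => rw [show y = y - 1 + 1 by omega]
  rw [List.take_add_one]

theorem drop_pred_eq_append_drop (w : List A) {y : ℕ} (h : 0 < y) :
    w.drop (y - 1) = w[y - 1]?.toList ++ w.drop y := by
  have h1 := List.drop_eq_getElem?_toList_append (l := w) (i := y - 1)
  rwa [show y - 1 + 1 = y by omega] at h1

/-- The position `z` of `w` is an `R`-descent. -/
def IsRDescent (w : List A) (z : ℕ) : Prop :=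
  ¬ ∃ c, wordVal φ (w.take z) * c = wordVal φ (w.take (z - 1))

/-- The position `z` of `w` is an `L`-descent. -/
def IsLDescent (w : List A) (z : ℕ) : Prop :=
  ¬ ∃ c, c * wordVal φ (w.drop (z - 1)) = wordVal φ (w.drop z)

theorem exists_mul_factor_eq {w : List A} {x y : ℕ} (hxy : x < y)
    (h : ∀ z, x < z → z < y → ¬ IsRDescent φ w z) :
    ∃ c, wordVal φ (w.take x) * wordVal φ (factor w x y) * c = wordVal φ (w.take x) := by
  have key : ∀ k, x + k < y → ∃ c, wordVal φ (w.take (x + k)) * c = wordVal φ (w.take x) := by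
    intro k
    induction k with
    | zero => exact fun _ => ⟨1, mul_one _⟩
    | succ k ih =>
      intro hk
      obtain ⟨c, hc⟩ := ih (by omega)
      obtain ⟨d, hd⟩ := not_not.1 (h (x + (k + 1)) (by omega) hk)
      exact ⟨d * c, by rw [← mul_assoc, hd, ← hc]; rfl⟩
  obtain ⟨c, hc⟩ := key (y - 1 - x) (by omega)
  rw [show x + (y - 1 - x) = y - 1 by omega, take_append_factor w hxy, wordVal_append] at hc
  exact ⟨c, hc⟩

theorem exists_factor_mul_eq {w : List A} {x y : ℕ} (hxy : x < y) (hy : y ≤ w.length + 1)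
    (h : ∀ z, x < z → z < y → ¬ IsLDescent φ w z) :
    ∃ c, c * (wordVal φ (factor w x y) * wordVal φ (w.drop (y - 1))) =
      wordVal φ (w.drop (y - 1)) := by
  have key : ∀ k, x + k < y →
      ∃ c, c * wordVal φ (w.drop (y - 1 - k)) = wordVal φ (w.drop (y - 1)) := by
    intro k
    induction k with
    | zero => exact fun _ => ⟨1, one_mul _⟩
    | succ k ih =>
      intro hk
      obtain ⟨c, hc⟩ := ih (by omega)
      obtain ⟨d, hd⟩ := not_not.1 (h (y - 1 - k) (by omega) (by omega))
      exact ⟨c * d, by rw [mul_assoc, ← Nat.sub_sub, hd, ← hc]⟩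
  obtain ⟨c, hc⟩ := key (y - 1 - x) (by omega)
  rw [show y - 1 - (y - 1 - x) = x by omega, factor_append_drop w hxy hy, wordVal_append] at hc
  exact ⟨c, hc⟩

variable {φ}

/-- With no descent in between, the prefix up to `x` is fixed by an idempotent `e` below the factor.
If `a` occurred in the factor, `e` would also be below the value of `a`, and DA would allow a return
after reading `a`. -/
theorem IsDA.notMem_factor_of_rDescent [Finite M] (hM : IsDA M) {w : List A} {x z : ℕ} {a : A}
    (hxz : x < z) (h : ∀ z', x < z' → z' < z → ¬ IsRDescent φ w z') (hz : IsRDescent φ w z)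
    (ha : w[z - 1]? = some a) : a ∉ factor w x z := by
  intro hmem
  obtain ⟨c, hc⟩ := exists_mul_factor_eq φ hxz h
  obtain ⟨e, he, hpe, t, ht⟩ := exists_idem_fix_right hc
  have hle : JLe e (wordVal φ (factor w x z)) := ht ▸ .mul_right _ _
  have h1 := hM.mul_fix_right he hpe (mul_mem (Submonoid.subset_closure hle)
    (Submonoid.subset_closure (hle.trans (jLe_wordVal_of_mem φ hmem))))
  refine hz ⟨e * wordVal φ (factor w x z), ?_⟩
  rw [take_eq_take_pred_append w (by omega), ha, Option.toList_some, take_append_factor w hxz,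
    wordVal_append, wordVal_append, ← mul_assoc, mul_assoc (wordVal φ (w.take x)), h1]

theorem IsDA.notMem_factor_of_lDescent [Finite M] (hM : IsDA M) {w : List A} {z y : ℕ} {a : A}
    (hz0 : 0 < z) (hzy : z < y) (hy : y ≤ w.length + 1)
    (h : ∀ z', z < z' → z' < y → ¬ IsLDescent φ w z') (hz : IsLDescent φ w z)
    (ha : w[z - 1]? = some a) : a ∉ factor w z y := by
  intro hmem
  obtain ⟨c, hc⟩ := exists_factor_mul_eq φ hzy hy h
  obtain ⟨e, he, hqe, t, ht⟩ := exists_idem_fix_left hc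
  have hle : JLe e (wordVal φ (factor w z y)) := ht ▸ .mul_left _ _
  have h1 := hM.mul_fix_left he hqe (mul_mem
    (Submonoid.subset_closure (hle.trans (jLe_wordVal_of_mem φ hmem)))
    (Submonoid.subset_closure hle))
  refine hz ⟨wordVal φ (factor w z y) * e, ?_⟩
  rw [drop_pred_eq_append_drop w hz0, ha, Option.toList_some, factor_append_drop w hzy hy,
    wordVal_append, wordVal_append, mul_assoc, ← mul_assoc (wordVal φ [a]), h1]

theorem mem_factor_of_getElem? {w : List A} {x y z : ℕ} {a : A} (hxz : x < z) (hzy : z < y)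
    (ha : w[z - 1]? = some a) : a ∈ factor w x y := by
  rw [List.mem_iff_getElem?]
  refine ⟨z - x - 1, ?_⟩
  rw [factor, List.getElem?_drop, List.getElem?_take, if_pos (by omega),
    show x + (z - x - 1) = z - 1 by omega, ha]

variable [DecidableEq A]

/-- The `R`-descents to the right of `x` are reached by the prefixes of a word of `X`-modalities. -/
theorem IsDA.exists_word_rDescent_aux [Finite M] (hM : IsDA M) (w : List A) (k : ℕ) :
    ∀ x, x ≤ w.length → {y | ∃ c, y = wordVal φ (w.take x) * c}.ncard ≤ k →
    ∃ ρ : List (Modality A), (∀ Z ∈ ρ, Z.isX = true) ∧ ρ.length ≤ k ∧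
      (evalFrom w ρ x).isSome ∧
      ∀ z, x < z → z ≤ w.length → IsRDescent φ w z → ∃ τ, τ <+: ρ ∧ evalFrom w τ x = some z := by
  induction k with
  | zero =>
    intro x _ hk
    rw [Nat.le_zero, Set.ncard_eq_zero (Set.toFinite _)] at hk
    exact absurd (show _ ∈ {y | ∃ c, y = wordVal φ (w.take x) * c} from ⟨1, rfl⟩)
      (hk ▸ Set.notMem_empty _)
  | succ k ih =>
    intro x hx hk
    classical
    by_cases hex : ∃ z, x < z ∧ z ≤ w.length ∧ IsRDescent φ w z
    · obtain ⟨z, hzdef⟩ : ∃ z, z = Nat.find hex := ⟨_, rfl⟩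
      obtain ⟨hxz, hzl, hz⟩ : x < z ∧ z ≤ w.length ∧ IsRDescent φ w z :=
        hzdef ▸ Nat.find_spec hex
      have hmin : ∀ z', x < z' → z' < z → ¬ IsRDescent φ w z' := fun z' h1 h2 h3 =>
        Nat.find_min hex (hzdef ▸ h2) ⟨h1, by omega, h3⟩
      obtain ⟨a, ha⟩ : ∃ a, w[z - 1]? = some a :=
        ⟨_, List.getElem?_eq_getElem (show z - 1 < w.length by omega)⟩
      have hnot := hM.notMem_factor_of_rDescent hxz hmin hz ha
      have hstep : (Modality.X a).step w x = some z :=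
        step_X_eq_some.2 ⟨hxz, ha, fun y h1 h2 h3 => hnot (mem_factor_of_getElem? h1 h2 h3)⟩
      obtain ⟨d, hd⟩ := exists_mul_factor_eq φ hxz hmin
      -- The right ideal generated by the prefix value shrinks strictly at a descent, so its size
      -- bounds the length of the word of modalities.
      have hlt : {y | ∃ c, y = wordVal φ (w.take z) * c}.ncard ≤ k := by
        refine Nat.lt_succ_iff.1 (lt_of_lt_of_le (Set.ncard_lt_ncard ?_) hk)
        refine ⟨?_, fun hc => ?_⟩
        · rintro _ ⟨c, rfl⟩
          refine ⟨wordVal φ (factor w x z) * wordVal φ [a] * c, ?_⟩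
          rw [take_eq_take_pred_append w (by omega), ha, Option.toList_some,
            take_append_factor w hxz, wordVal_append, wordVal_append]
          simp only [mul_assoc]
        · obtain ⟨c, hc⟩ := hc ⟨1, (mul_one _).symm⟩
          refine hz ⟨c * wordVal φ (factor w x z), ?_⟩
          rw [← mul_assoc, ← hc, take_append_factor w hxz, wordVal_append]
      obtain ⟨ρ, h1, h2, h3, h4⟩ := ih z hzl hlt
      have hcons : ∀ τ : List (Modality A),
          evalFrom w (Modality.X a :: τ) x = evalFrom w τ z := by
        intro τ
        rw [evalFrom, hstep, Option.bind_some]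
      refine ⟨Modality.X a :: ρ, ?_, by simpa using h2, by rwa [hcons], ?_⟩
      · intro Z hZ
        rcases List.mem_cons.1 hZ with rfl | hZ
        · rfl
        · exact h1 Z hZ
      · intro z' hz' hz'l hz'd
        rcases lt_trichotomy z z' with hlt | rfl | hlt
        · obtain ⟨τ, hτ, hτe⟩ := h4 z' hlt hz'l hz'd
          exact ⟨Modality.X a :: τ, (List.prefix_cons_inj _).2 hτ, by rw [hcons, hτe]⟩
        · exact ⟨[Modality.X a], (List.prefix_cons_inj _).2 List.nil_prefix, by rw [hcons]; rfl⟩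
        · exact absurd hz'd (hmin z' hz' hlt)
    · exact ⟨[], by simp, by simp, rfl, fun z h1 h2 h3 => absurd ⟨z, h1, h2, h3⟩ hex⟩

/-- The `L`-descents to the left of `y` are reached by the prefixes of a word of `Y`-modalities. -/
theorem IsDA.exists_word_lDescent_aux [Finite M] (hM : IsDA M) (w : List A) (k : ℕ) :
    ∀ y, y ≤ w.length + 1 → {x | ∃ c, x = c * wordVal φ (w.drop (y - 1))}.ncard ≤ k →
    ∃ ρ : List (Modality A), (∀ Z ∈ ρ, Z.isX = false) ∧ ρ.length ≤ k ∧
      (evalFrom w ρ y).isSome ∧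
      ∀ z, 0 < z → z < y → IsLDescent φ w z → ∃ τ, τ <+: ρ ∧ evalFrom w τ y = some z := by
  induction k with
  | zero =>
    intro y _ hk
    rw [Nat.le_zero, Set.ncard_eq_zero (Set.toFinite _)] at hk
    exact absurd (show _ ∈ {x | ∃ c, x = c * wordVal φ (w.drop (y - 1))} from ⟨1, rfl⟩)
      (hk ▸ Set.notMem_empty _)
  | succ k ih =>
    intro y hy hk
    by_cases hex : {z | 0 < z ∧ z < y ∧ IsLDescent φ w z}.Nonempty
    · have hbdd : BddAbove {z | 0 < z ∧ z < y ∧ IsLDescent φ w z} := ⟨y, fun z hz => hz.2.1.le⟩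
      obtain ⟨z, hzdef⟩ : ∃ z, z = sSup {z | 0 < z ∧ z < y ∧ IsLDescent φ w z} := ⟨_, rfl⟩
      obtain ⟨hz0, hzy, hz⟩ : z ∈ {z | 0 < z ∧ z < y ∧ IsLDescent φ w z} :=
        hzdef ▸ Nat.sSup_mem hex hbdd
      have hmin : ∀ z', z < z' → z' < y → ¬ IsLDescent φ w z' := fun z' h1 h2 h3 =>
        absurd (le_csSup hbdd ⟨by omega, h2, h3⟩ : z' ≤ _) (by omega)
      obtain ⟨a, ha⟩ : ∃ a, w[z - 1]? = some a :=
        ⟨_, List.getElem?_eq_getElem (show z - 1 < w.length by omega)⟩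
      have hnot := hM.notMem_factor_of_lDescent hz0 hzy hy hmin hz ha
      have hstep : (Modality.Y a).step w y = some z :=
        step_Y_eq_some.2
          ⟨hz0, hzy, ha, fun y h1 h2 h3 => hnot (mem_factor_of_getElem? h1 h2 h3)⟩
      obtain ⟨d, hd⟩ := exists_factor_mul_eq φ hzy hy hmin
      have hlt : {x | ∃ c, x = c * wordVal φ (w.drop (z - 1))}.ncard ≤ k := by
        refine Nat.lt_succ_iff.1 (lt_of_lt_of_le (Set.ncard_lt_ncard ?_) hk)
        refine ⟨?_, fun hc => ?_⟩
        · rintro _ ⟨c, rfl⟩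
          refine ⟨c * (wordVal φ [a] * wordVal φ (factor w z y)), ?_⟩
          rw [drop_pred_eq_append_drop w hz0, ha, Option.toList_some,
            factor_append_drop w hzy hy, wordVal_append, wordVal_append]
          simp only [mul_assoc]
        · obtain ⟨c, hc⟩ := hc ⟨1, (one_mul _).symm⟩
          refine hz ⟨wordVal φ (factor w z y) * c, ?_⟩
          rw [mul_assoc, ← hc, factor_append_drop w hzy hy, wordVal_append]
      obtain ⟨ρ, h1, h2, h3, h4⟩ := ih z (by omega) hlt
      have hcons : ∀ τ : List (Modality A),
          evalFrom w (Modality.Y a :: τ) y = evalFrom w τ z := by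
        intro τ
        rw [evalFrom, hstep, Option.bind_some]
      refine ⟨Modality.Y a :: ρ, ?_, by simpa using h2, by rwa [hcons], ?_⟩
      · intro Z hZ
        rcases List.mem_cons.1 hZ with rfl | hZ
        · rfl
        · exact h1 Z hZ
      · intro z' hz' hz'l hz'd
        rcases lt_trichotomy z' z with hlt | rfl | hlt
        · obtain ⟨τ, hτ, hτe⟩ := h4 z' hz' hlt hz'd
          exact ⟨Modality.Y a :: τ, (List.prefix_cons_inj _).2 hτ, by rw [hcons, hτe]⟩
        · exact ⟨[Modality.Y a], (List.prefix_cons_inj _).2 List.nil_prefix, by rw [hcons]; rfl⟩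
        · exact absurd hz'd (hmin z' hlt hz'l)
    · exact ⟨[], by simp, by simp, rfl, fun z h1 h2 h3 => absurd ⟨z, h1, h2, h3⟩ hex⟩

theorem IsDA.exists_word_rDescent [Finite M] (hM : IsDA M) (w : List A) :
    ∃ ρ : List (Modality A), (∀ Z ∈ ρ, Z.isX = true) ∧ ρ.length ≤ Nat.card M ∧
      (evalFrom w ρ (startPos true w)).isSome ∧
      ∀ z, 0 < z → z ≤ w.length → IsRDescent φ w z →
        ∃ τ, τ <+: ρ ∧ evalFrom w τ (startPos true w) = some z :=
  hM.exists_word_rDescent_aux w (Nat.card M) 0 (Nat.zero_le _) (Set.ncard_le_card _)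

theorem IsDA.exists_word_lDescent [Finite M] (hM : IsDA M) (w : List A) :
    ∃ ρ : List (Modality A), (∀ Z ∈ ρ, Z.isX = false) ∧ ρ.length ≤ Nat.card M ∧
      (evalFrom w ρ (startPos false w)).isSome ∧
      ∀ z, 0 < z → z ≤ w.length → IsLDescent φ w z →
        ∃ τ, τ <+: ρ ∧ evalFrom w τ (startPos false w) = some z := by
  obtain ⟨ρ, h1, h2, h3, h4⟩ := hM.exists_word_lDescent_aux (φ := φ) w (Nat.card M)
    (w.length + 1) le_rfl (Set.ncard_le_card _)
  exact ⟨ρ, h1, h2, h3, fun z hz hz' => h4 z hz (by omega)⟩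

end Descents

/-! ### Comparison of equivalent words -/

section Main

variable {A : Type u} [DecidableEq A] {M : Type v} [Monoid M] {φ : FreeMonoid A →* M}

/-- If factors between marked positions can be exchanged in stable contexts, then equivalent words
have the same image. -/
theorem IsDA.wordVal_eq_of_exchange [Finite M] (hM : IsDA M) {m n : ℕ} (hm : 1 ≤ m)
    (hn : Nat.card M + 1 ≤ n) {w w' : List A} (hE : RankerEquiv m n w w')
    (H : ∀ b c ρ σ x x' y y', IsMarkPair w w' (Nat.card M) b c ρ σ x x' y y' →
      (∃ z, wordVal φ (w.take x) * wordVal φ (factor w x y) * z = wordVal φ (w.take x)) →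
      (∃ z, z * (wordVal φ (factor w' x' y') * wordVal φ (w'.drop (y' - 1))) =
        wordVal φ (w'.drop (y' - 1))) →
      wordVal φ (w.take x) * wordVal φ (factor w x y) * wordVal φ (w'.drop (y' - 1)) =
        wordVal φ (w.take x) * wordVal φ (factor w' x' y') * wordVal φ (w'.drop (y' - 1))) :
    wordVal φ w = wordVal φ w' := by
  obtain ⟨ρX, hX, hXl, hXs, hXd⟩ := hM.exists_word_rDescent (φ := φ) w
  obtain ⟨ρY, hY, hYl, hYs, hYd⟩ := hM.exists_word_lDescent (φ := φ) w'
  obtain ⟨ρ, hρ⟩ : ∃ ρ : Bool → List (Modality A), ρ = fun b => if b then ρX else ρY := ⟨_, rfl⟩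
  have hρb : ∀ b, ∀ Z ∈ ρ b, Z.isX = b := by
    intro b
    cases b <;> simpa [hρ]
  have hρl : ∀ b, (ρ b).length ≤ Nat.card M := by
    intro b
    cases b <;> simpa [hρ]
  have hiff : ∀ b (τ : List (Modality A)), τ <+: ρ b →
      ((evalFrom w τ (startPos b w)).isSome ↔ (evalFrom w' τ (startPos b w')).isSome) := by
    intro b τ hτ
    have hb : ∀ Z ∈ τ, Z.isX = b := fun Z hZ => hρb b Z (hτ.subset hZ)
    have hl := hτ.length_le.trans (hρl b)
    cases τ with
    | nil => exact ⟨fun _ => rfl, fun _ => rfl⟩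
    | cons Z τ =>
      have h1 := hE.defined (Z :: τ) ⟨by simp, by omega, (blocks_le_one hb).trans hm⟩
      rwa [eval_cons, eval_cons, hb Z List.mem_cons_self] at h1
  have hmark : ∀ b (τ : List (Modality A)) x x', τ <+: ρ b →
      evalFrom w τ (startPos b w) = some x → evalFrom w' τ (startPos b w') = some x' →
      IsMark w w' (Nat.card M) b τ x x' := fun b τ x x' hτ h1 h2 =>
    ⟨fun Z hZ => hρb b Z (hτ.subset hZ), hτ.length_le.trans (hρl b), h1, h2⟩
  -- `E` pairs corresponding marks: positions reached on `w` and `w'` by the same prefix of one of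
  -- the two descent words.
  obtain ⟨E, hEdef⟩ : ∃ E : ℕ → ℕ → Prop, ∀ x x', E x x' ↔
      ∃ b τ, τ <+: ρ b ∧ IsMark w w' (Nat.card M) b τ x x' := ⟨_, fun _ _ => Iff.rfl⟩
  have hord : ∀ x x' y y', E x x' → E y y' → (x < y ↔ x' < y') ∧ (y < x ↔ y' < x') := by
    intro x x' y y' h h'
    obtain ⟨b, τ, hτ, h⟩ := (hEdef _ _).1 h
    obtain ⟨c, υ, hυ, h'⟩ := (hEdef _ _).1 h'
    by_cases hbc : b = c
    · subst hbc
      rcases List.prefix_or_prefix_of_prefix hτ hυ with hp | hp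
      · exact h.lt_of_prefix h' hp
      · exact (h'.lt_of_prefix h hp).symm
    · exact h.lt_iff_of_ne h' hE hm hn hbc
  have h0 : E 0 0 := (hEdef _ _).2 ⟨true, [], List.nil_prefix, hmark _ _ _ _ List.nil_prefix rfl rfl⟩
  have hend : E (w.length + 1) (w'.length + 1) :=
    (hEdef _ _).2 ⟨false, [], List.nil_prefix, hmark _ _ _ _ List.nil_prefix rfl rfl⟩
  have hRd : ∀ z, 0 < z → z ≤ w.length → IsRDescent φ w z → ∃ z', E z z' := by
    intro z h1 h2 h3
    obtain ⟨τ, hτ, hτe⟩ := hXd z h1 h2 h3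
    have hτ' : τ <+: ρ true := by simpa [hρ] using hτ
    obtain ⟨z', hz'⟩ := Option.isSome_iff_exists.1
      ((hiff true τ hτ').1 (Option.isSome_iff_exists.2 ⟨z, hτe⟩))
    exact ⟨z', (hEdef _ _).2 ⟨true, τ, hτ', hmark _ _ _ _ hτ' hτe hz'⟩⟩
  have hLd : ∀ z', 0 < z' → z' ≤ w'.length → IsLDescent φ w' z' → ∃ z, E z z' := by
    intro z' h1 h2 h3
    obtain ⟨τ, hτ, hτe⟩ := hYd z' h1 h2 h3
    have hτ' : τ <+: ρ false := by simpa [hρ] using hτ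
    obtain ⟨z, hz⟩ := Option.isSome_iff_exists.1
      ((hiff false τ hτ').2 (Option.isSome_iff_exists.2 ⟨z', hτe⟩))
    exact ⟨z, (hEdef _ _).2 ⟨false, τ, hτ', hmark _ _ _ _ hτ' hz hτe⟩⟩
  -- Invariant of the exchange: a prefix of `w` followed by the matching suffix of `w'` has the
  -- value of `w'`.
  have key : ∀ y y', E y y' →
      wordVal φ (w.take y) * wordVal φ (w'.drop y') = wordVal φ w' := by
    intro y
    induction y using Nat.strong_induction_on with
    | _ y ih =>
      intro y' hy
      rcases Nat.eq_zero_or_pos y with rfl | hpos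
      · have := hord _ _ _ _ h0 hy
        have hy'0 : y' = 0 := by omega
        rw [hy'0, List.take_zero, wordVal_nil, one_mul, List.drop_zero]
      · have hne : {x | x < y ∧ ∃ x', E x x'}.Nonempty := ⟨0, hpos, 0, h0⟩
        have hbdd : BddAbove {x | x < y ∧ ∃ x', E x x'} := ⟨y, fun z hz => hz.1.le⟩
        -- The nearest mark to the left of `y`; order preservation makes its partner consecutive to
        -- `y'` in `w'` as well.
        obtain ⟨x, hxdef⟩ : ∃ x, x = sSup {x | x < y ∧ ∃ x', E x x'} := ⟨_, rfl⟩
        obtain ⟨hxy, x', hx⟩ : x ∈ {x | x < y ∧ ∃ x', E x x'} := hxdef ▸ Nat.sSup_mem hne hbdd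
        have hgap : ∀ z z', E z z' → x < z → z < y → False := fun z z' h1 h2 h3 =>
          absurd (le_csSup hbdd ⟨h3, z', h1⟩ : z ≤ _) (by omega)
        have hxy' := (hord _ _ _ _ hx hy).1.1 hxy
        obtain ⟨b, τ, hτ, hmx⟩ := (hEdef _ _).1 hx
        obtain ⟨c, υ, hυ, hmy⟩ := (hEdef _ _).1 hy
        have hyl := le_of_evalFrom_startPos hmy.eval_left
        have hyl' := le_of_evalFrom_startPos hmy.eval_right
        have hH := H b c τ υ x x' y y' ⟨hmx, hmy, hxy, hxy'⟩
          (exists_mul_factor_eq φ hxy fun z h1 h2 h3 => by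
            obtain ⟨z', hz'⟩ := hRd z (by omega) (by omega) h3
            exact hgap z z' hz' h1 h2)
          (exists_factor_mul_eq φ hxy' hyl' fun z' h1 h2 h3 => by
            obtain ⟨z, hz⟩ := hLd z' (by omega) (by omega) h3
            exact hgap z z' hz ((hord _ _ _ _ hx hz).1.2 h1) ((hord _ _ _ _ hz hy).1.2 h2))
        rw [← ih x hxy x' hx, factor_append_drop w' hxy' hyl', wordVal_append φ (factor w' x' y'),
          ← mul_assoc, ← hH, take_eq_take_pred_append w hpos, take_append_factor w hxy,
          drop_pred_eq_append_drop w' (by omega : 0 < y'), hmy.getElem?_eq hpos]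
        simp only [wordVal_append, mul_assoc]
  -- At the right ends the prefix is all of `w` and the suffix is empty.
  have := key _ _ hend
  rwa [List.take_of_length_le (Nat.le_succ _), List.drop_of_length_le (Nat.le_succ _), wordVal_nil,
    mul_one] at this

/-- The morphism that agrees with `φ` on the letters in `B` and erases the other letters. -/
def eraseHom (φ : FreeMonoid A →* M) (B : Finset A) : FreeMonoid A →* M :=
  FreeMonoid.lift fun a => if a ∈ B then φ (FreeMonoid.of a) else 1

theorem wordVal_eraseHom {B : Finset A} {w : List A} (h : ∀ a ∈ w, a ∈ B) :
    wordVal (eraseHom φ B) w = wordVal φ w := by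
  induction w with
  | nil => rw [wordVal_nil, wordVal_nil]
  | cons a w ih =>
    rw [← List.singleton_append, wordVal_append, wordVal_append,
      ih fun b hb => h b (List.mem_cons_of_mem _ hb)]
    congr 1
    change eraseHom φ B (FreeMonoid.of a) = φ (FreeMonoid.of a)
    rw [eraseHom, FreeMonoid.lift_eval_of, if_pos (h a List.mem_cons_self)]

/-- The range is generated by `1` and the values of letters of `w`, all of them `J`-above the value
of `w`. -/
theorem mrange_eraseHom_le {B : Finset A} {w : List A} (h : ∀ a ∈ B, a ∈ w) {e : M}
    (he : JLe e (wordVal φ w)) :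
    MonoidHom.mrange (eraseHom φ B) ≤ Submonoid.closure {y : M | JLe e y} := by
  rw [eraseHom, FreeMonoid.mrange_lift, Submonoid.closure_le]
  rintro _ ⟨a, rfl⟩
  by_cases ha : a ∈ B
  · simp only [if_pos ha]
    exact Submonoid.subset_closure (he.trans (jLe_wordVal_of_mem φ (h a ha)))
  · simp only [if_neg ha]
    exact one_mem _

/-- The monoid is quantified inside the induction because the hypothesis is applied to quotients of
submonoids of `M`. The depth must precede the words, so all alphabets `B` of factors are treated at
once; erasing letters keeps every morphism defined on all of `A`. -/
theorem exists_depth_wordVal_eq [Finite A] (m : ℕ) : ∀ (M : Type v) [Monoid M] [Finite M]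
    (φ : FreeMonoid A →* M), ClassR (m + 2) M → ClassL (m + 2) M →
    ∃ n : ℕ, ∀ w w' : List A, RankerEquiv (m + 1) n w w' → wordVal φ w = wordVal φ w' := by
  induction m with
  | zero =>
    intro M _ _ φ hR hL
    have hM := (isDA_of_class 1 M).1 hR
    refine ⟨Nat.card M + 1, fun w w' hE => hM.wordVal_eq_of_exchange le_rfl le_rfl hE ?_⟩
    rintro b c ρ σ x x' y y' - ⟨z, hz⟩ ⟨z', hz'⟩
    rw [mul_eq_of_classR_two hR hz, mul_assoc, mul_eq_of_classL_two hL hz']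
  | succ m ih =>
    intro M _ _ φ hR hL
    have hM := (isDA_of_class (m + 2) M).1 hR
    have := Fintype.ofFinite A
    have hB : ∀ B : Finset A, ∃ n : ℕ, ∀ w w' : List A, RankerEquiv (m + 1) n w w' →
        ((KCon M).comap (MonoidHom.mrange (eraseHom φ B)).subtype (fun _ _ => rfl) ⊔
          (DCon M).comap (MonoidHom.mrange (eraseHom φ B)).subtype (fun _ _ => rfl))
          ((eraseHom φ B).mrangeRestrict (FreeMonoid.ofList w))
          ((eraseHom φ B).mrangeRestrict (FreeMonoid.ofList w')) := by
      intro B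
      have hc := class_sup_quotient hR hL (MonoidHom.mrange (eraseHom φ B))
      obtain ⟨n, hn⟩ := ih _ ((Con.mk' _).comp (eraseHom φ B).mrangeRestrict) hc.1 hc.2
      exact ⟨n, fun w w' hE => (Con.eq _).1 (hn w w' hE)⟩
    choose k hk using hB
    -- `|M|` pays for a mark and `sup k` for the induction hypothesis over every `B`. The inner `+
    -- 1` ensures that letters of factors are detected, the outer one pays for the symmetric
    -- comparison of rankers.
    refine ⟨Nat.card M + (Finset.univ.sup k + 1) + 1,
      fun w w' hE => hM.wordVal_eq_of_exchange (by omega) (by omega) hE ?_⟩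
    rintro b c ρ σ x x' y y' hp ⟨z, hz⟩ ⟨z', hz'⟩
    have hF : RankerEquiv (m + 1) (Finset.univ.sup k + 1) (factor w x y) (factor w' x' y') :=
      hp.factor_equiv hE (by omega) le_rfl
    -- Both factors have alphabet `B`, so one submonoid lies above both the idempotent fixing the
    -- left context and the one fixing the right context.
    obtain ⟨B, hBdef⟩ : ∃ B, B = (factor w x y).toFinset := ⟨_, rfl⟩
    have h1 : ∀ a, a ∈ B ↔ a ∈ factor w x y := fun a => by rw [hBdef, List.mem_toFinset]
    have h2 : ∀ a, a ∈ B ↔ a ∈ factor w' x' y' := fun a =>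
      (h1 a).trans (hF.mem_iff (by omega) (by omega) a)
    obtain ⟨e, he, hpe, t, ht⟩ := exists_idem_fix_right hz
    obtain ⟨f, hf, hqf, t', ht'⟩ := exists_idem_fix_left hz'
    have hrel := hk B _ _ (hF.mono ((Finset.le_sup (Finset.mem_univ B)).trans (Nat.le_succ _)))
    have h3 := mul_eq_of_sup_rel hM he hpe hf hqf
      (mrange_eraseHom_le (fun a ha => (h1 a).1 ha) (ht ▸ .mul_right _ _))
      (mrange_eraseHom_le (fun a ha => (h2 a).1 ha) (ht' ▸ .mul_left _ _)) hrel
    rw [← wordVal_eraseHom fun a ha => (h1 a).2 ha, ← wordVal_eraseHom fun a ha => (h2 a).2 ha]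
    exact h3

end Main

end RankerHierarchy

theorem mainTheorem2 (m : ℕ) (hm : 1 ≤ m) {A : Type*} [Finite A] [DecidableEq A]
    {M : Type*} [Monoid M] [Finite M] (φ : FreeMonoid A →* M)
    (hR : RankerHierarchy.ClassR (m + 1) M) (hL : RankerHierarchy.ClassL (m + 1) M) :
    ∃ n : ℕ, ∀ w w' : FreeMonoid A,
      RankerHierarchy.RankerEquiv m n w.toList w'.toList → φ w = φ w' := by
  obtain ⟨k, rfl⟩ : ∃ k, m = k + 1 := ⟨m - 1, by omega⟩
  obtain ⟨n, hn⟩ := RankerHierarchy.exists_depth_wordVal_eq k M φ hR hL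
  exact ⟨n, fun w w' h => hn _ _ h⟩
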